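/- For a partition $\lambda$ with Frobenius coordinates $(a_1,\dots,a_d\,|\,b_1,\dots,b_d)$, where $d$ is the number of diagonal cells of its Young diagram, $a_i=\lambda_i-i+\tfrac12$ and $b_i=\lambda'_i-i+\tfrac12$ ($\lambda'$ being the conjugate partition), let $$p_k^{\mathrm F}(\lambda)=\sum_{i=1}^d a_i^k+(-1)^{k-1}\sum_{i=1}^d b_i^k\qquad(k\ge 1)$$ be its Frobenius moments. A descent of a standard tableau $T$ with $n$ cells is an $i\in\{1,\dots,n-1\}$ such that $i+1$ lies in a row of larger index than the row containing $i$ (row $1$ being the longest row), and $\mathrm{maj}(T)$ is the sum of the descents of $T$. The cumulants $\kappa^{(r)}(X)$ of a random variable $X$ are given by $\log\mathbb E[\mathrm e^{zX}]=\sum_{r\ge1}\frac{\kappa^{(r)}(X)}{r!}z^r$ near $z=0$, and the Bernoulli numbers $B_r$ by $\frac{t}{1-\mathrm e^{-t}}=\sum_{r\ge0}B_r\frac{t^r}{r!}$. A sequence $(\lambda^{(n)})_{n\ge1}$ of partitions is called growing if $|\lambda^{(n)}|=n$ for all $n\ge1$. **Theorem.** Let $r\ge2$. There is a constant $C_r$,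 depending only on $r$, such that for every growing sequence $(\lambda^{(n)})_{n\ge1}$ and every $n\ge1$, if $T^{(n)}$ is a uniformly random standard tableau of shape $\lambda^{(n)}$, then $$\left|\kappa^{(r)}(\mathrm{maj}(T^{(n)}))-\frac{B_r}{r(r+1)}\Big((p_1^{\mathrm F})^{r+1}-p_{r+1}^{\mathrm F}\Big)-\frac{B_r}{2r}\Big((p_1^{\mathrm F})^r+\sum_{s=1}^{r-1}\binom rs(-1)^s\,p_s^{\mathrm F}\,p_{r-s}^{\mathrm F}\Big)\right|\le C_r\,n^{r-1},$$ where $p_k^{\mathrm F}=p_k^{\mathrm F}(\lambda^{(n)})$. -/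

import Mathlib

open MeasureTheory ProbabilityTheory

noncomputable section

/-- A standard tableau of shape `μ`: a bijective numbering of the cells of `μ` by `1, …, |μ|` that is
strictly increasing along the rows and along the columns. A cell is a pair `(row, column)`, counted
from `0`; row `0` is the longest row. -/
structure StandardTableau (μ : YoungDiagram) where
  entry : {c : ℕ × ℕ // c ∈ μ.cells} ≃ {k : ℕ // k ∈ Finset.Icc 1 μ.card}
  row_strict : ∀ c d : {c : ℕ × ℕ // c ∈ μ.cells},
    c.1.1 = d.1.1 → c.1.2 < d.1.2 → (entry c : ℕ) < (entry d : ℕ)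
  col_strict : ∀ c d : {c : ℕ × ℕ // c ∈ μ.cells},
    c.1.2 = d.1.2 → c.1.1 < d.1.1 → (entry c : ℕ) < (entry d : ℕ)

namespace StandardTableau

/-- The (finite) set of standard tableaux of shape `μ` carries the discrete σ-algebra. -/
instance instMeasurableSpace (μ : YoungDiagram) : MeasurableSpace (StandardTableau μ) := ⊤

/-- `i` is a descent of `T` if `i` and `i + 1` are entries of `T` and `i + 1` lies in a row of larger
index than the row of `i` (that is, strictly above it when rows are stacked upwards). -/
def IsDescent {μ : YoungDiagram} (T : StandardTableau μ) (i : ℕ) : Prop :=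
  ∃ c d : {c : ℕ × ℕ // c ∈ μ.cells},
    (T.entry c : ℕ) = i ∧ (T.entry d : ℕ) = i + 1 ∧ c.1.1 < d.1.1

open Classical in
/-- The major index: the sum of the descents. -/
def maj {μ : YoungDiagram} (T : StandardTableau μ) : ℕ :=
  ∑ i ∈ (Finset.Icc 1 (μ.card - 1)).filter (fun i => T.IsDescent i), i

/-- The uniform law on the standard tableaux of shape `μ`. -/
def uniformLaw (μ : YoungDiagram) : Measure (StandardTableau μ) :=
  uniformOn Set.univ

end StandardTableau

/-- The `r`-th cumulant of a real random variable `X` whose Laplace transform is finite near `0`: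
`r!` times the coefficient of `z ^ r` in the Taylor series at `0` of `z ↦ log 𝔼[exp (z X)]`. -/
def cumulant {Ω : Type*} [MeasurableSpace Ω] (r : ℕ) (X : Ω → ℝ) (P : Measure Ω) : ℝ :=
  iteratedDeriv r (cgf X P) 0

namespace YoungDiagram

/-- The number `d` of diagonal cells; these are the cells `(i, i)` with `i < d`. -/
def diagLen (μ : YoungDiagram) : ℕ :=
  (μ.cells.filter (fun c => c.1 = c.2)).card

/-- The Frobenius coordinate `a_{i+1} = μ_{i+1} - (i+1) + 1/2` (for `i < d`). -/
def frobeniusA (μ : YoungDiagram) (i : ℕ) : ℝ :=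
  (μ.rowLen i : ℝ) - (i : ℝ) - 1 / 2

/-- The Frobenius coordinate `b_{i+1} = μ'_{i+1} - (i+1) + 1/2` (for `i < d`). -/
def frobeniusB (μ : YoungDiagram) (i : ℕ) : ℝ :=
  (μ.colLen i : ℝ) - (i : ℝ) - 1 / 2

/-- The Frobenius moment `p_k(μ) = ∑ a_i ^ k + (-1) ^ (k - 1) ∑ b_i ^ k`, for `k ≥ 1`. -/
def frobeniusMoment (k : ℕ) (μ : YoungDiagram) : ℝ :=
  ∑ i ∈ Finset.range μ.diagLen, μ.frobeniusA i ^ k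
    + (-1) ^ (k - 1) * ∑ i ∈ Finset.range μ.diagLen, μ.frobeniusB i ^ k

end YoungDiagram

/-- A sequence `(λ⁽ⁿ⁾)_{n ≥ 1}` of partitions is growing if `|λ⁽ⁿ⁾| = n` for every `n ≥ 1`. -/
def IsGrowing (lam : ℕ → YoungDiagram) : Prop :=
  ∀ n : ℕ, 1 ≤ n → (lam n).card = n

end

/-!
The cumulants of the major index have an exact expression as power sums, and the theorem is what is
left of it after Faulhaber's formula.

The generating function `∑ q ^ maj T` over the standard tableaux of a shape is a product of factors
`1 - q ^ m` (Stanley's `q`-analogue of the hook length formula, `sum_pow_maj_mul`). Hook lengths do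
not occur: with `l_a = μ_a + k - 1 - a`, the product is a Vandermonde determinant in the `q ^ l_a`
divided by Pochhammer symbols `(q; q)_{l_a}`. The proof is an induction on the number of cells. The
statistic is refined to `extendedMaj`, which also records whether the largest entry lies above a
given row `i`; removing the largest entry gives a recursion for its generating function
(`majGen_eq_sum`). The determinants `stripDet`, of Jacobi–Trudi type, with the rows above `i`
evaluated at `q, q², …` and the others at `1, q, q², …`, satisfy the same recursion, since
`h_m(1, q, …) = h_m(q, q², …) + h_{m - 1}(1, q, …)` (`stripDet_sub_stripDet`, `majGen_mul_stripDet`).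

At `q = exp z` every factor `1 - q ^ m` contributes `g (m z)` to the cumulant generating function,
where `g z = log ((exp z - 1) / z)`, up to terms that cancel or are affine in `z`. As `g` has `r`-th
derivative `B_r / r` at `0` (`iteratedDeriv_logExpDiv_zero`), this gives the exact formula
`cumulant_maj`. For odd `r` everything vanishes with `B_r`.

For even `r` the differences `l_a - l_b` are interactions between the particles of the Maya diagram
of `μ`. The particles form the filled sea of the empty diagram plus a signed measure carried by the
Frobenius coordinates (`sum_shiftedRow_sub`), of mass `0` and with the Frobenius moments as moments.
Expanding the interaction (`powerDefect_sub`), the part that is quadratic in this measure is the sum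
of products of Frobenius moments, and the mixed part is a sum of power sums
`1 ^ r + ⋯ + m ^ r` with `m + 1/2` a Frobenius coordinate. The latter is
`(m + 1/2) ^ (r + 1) / (r + 1) + O((m + 1/2) ^ (r - 1))` (`exists_bound_powerSum_half`), and the
errors add up to `O(n ^ (r - 1))` because the Frobenius coordinates are nonnegative with sum `n`.
-/

noncomputable section

open Finset

/-! ### Determinants for the principal specialization of Schur functions -/

/-- The `q`-Pochhammer symbol `(q; q)_n = (1 - q)(1 - q²)⋯(1 - qⁿ)`. -/
def qPoch (q : ℝ) (n : ℕ) : ℝ := ∏ i ∈ range n, (1 - q ^ (i + 1))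

lemma qPoch_succ (q : ℝ) (n : ℕ) : qPoch q (n + 1) = qPoch q n * (1 - q ^ (n + 1)) :=
  prod_range_succ _ _

lemma one_sub_pow_ne_zero {q : ℝ} (h0 : 0 < q) (h1 : q ≠ 1) {n : ℕ} (hn : n ≠ 0) :
    1 - q ^ n ≠ 0 := by
  intro h
  exact h1 ((pow_eq_one_iff_of_nonneg h0.le hn).1 (by linarith))

lemma qPoch_ne_zero {q : ℝ} (h0 : 0 < q) (h1 : q ≠ 1) (n : ℕ) : qPoch q n ≠ 0 :=
  prod_ne_zero_iff.2 fun i _ => one_sub_pow_ne_zero h0 h1 i.succ_ne_zero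

/-- The complete homogeneous symmetric function `h_{l - b}` at `1, q, q², …`, namely
`1 / (q; q)_{l - b}`, which is `0` for `l < b`. -/
def qComplete (q : ℝ) (l b : ℕ) : ℝ := if b ≤ l then (qPoch q (l - b))⁻¹ else 0

/-- The identity `h_m(1, q, …) = h_m(q, q², …) + h_{m - 1}(1, q, …)`. -/
lemma qComplete_succ {q : ℝ} (h0 : 0 < q) (h1 : q ≠ 1) (l b : ℕ) :
    qComplete q (l + 1) b = q ^ (l + 1 - b) * qComplete q (l + 1) b + qComplete q l b := by
  unfold qComplete
  rcases lt_trichotomy b (l + 1) with h | h | h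
  · have hb : b ≤ l := by omega
    obtain ⟨m, rfl⟩ := Nat.exists_eq_add_of_le hb
    have e1 : b + m + 1 - b = m + 1 := by omega
    have e2 : b + m - b = m := by omega
    rw [if_pos h.le, if_pos hb, e1, e2, qPoch_succ]
    have := qPoch_ne_zero h0 h1 m
    have := one_sub_pow_ne_zero h0 h1 m.succ_ne_zero
    field_simp
    ring
  · subst h
    simp
  · rw [if_neg (by omega), if_neg (by omega)]
    simp

/-- The Jacobi–Trudi type matrix `h_{l_a - b}`, whose rows of index `< i` are evaluated at
`q, q², …` and whose other rows are evaluated at `1, q, q², …`. For `l` the strictly decreasing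
sequence attached to a partition `λ`, its determinant is up to sign the sum of
`s_μ(q, q², …)` over the `μ ⊆ λ` such that `λ / μ` is a horizontal strip in the rows of
index `≥ i`. -/
def stripMatrix (q : ℝ) {k : ℕ} (l : Fin k → ℕ) (i : ℕ) : Matrix (Fin k) (Fin k) ℝ :=
  Matrix.of fun a b => (if (a : ℕ) < i then q ^ (l a - b) else 1) * qComplete q (l a) b

/-- The determinant of `stripMatrix`. -/
def stripDet (q : ℝ) {k : ℕ} (l : Fin k → ℕ) (i : ℕ) : ℝ := (stripMatrix q l i).det

lemma stripMatrix_succ_of_ne (q : ℝ) {k : ℕ} (l : Fin k → ℕ) {i a : Fin k} (h : a ≠ i) (b : Fin k) :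
    stripMatrix q l (i + 1) a b = stripMatrix q l i a b := by
  have h' : (a : ℕ) ≠ i := fun e => h (Fin.ext e)
  have : (a : ℕ) < i + 1 ↔ (a : ℕ) < i := by omega
  simp only [stripMatrix, Matrix.of_apply, this]

lemma stripMatrix_eq_updateRow (q : ℝ) {k : ℕ} (l : Fin k → ℕ) (i : Fin k) :
    stripMatrix q l i
      = (stripMatrix q l (i + 1)).updateRow i (fun b => qComplete q (l i) b) := by
  ext a b
  by_cases h : a = i
  · subst h; simp [stripMatrix]
  · rw [Matrix.updateRow_ne h, stripMatrix_succ_of_ne q l h]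

lemma stripMatrix_update_eq_updateRow (q : ℝ) {k : ℕ} (l : Fin k → ℕ) (i : Fin k) (m : ℕ) :
    stripMatrix q (Function.update l i m) i
      = (stripMatrix q l (i + 1)).updateRow i (fun b => qComplete q m b) := by
  ext a b
  by_cases h : a = i
  · subst h; simp [stripMatrix]
  · rw [Matrix.updateRow_ne h, stripMatrix_succ_of_ne q l h]
    simp only [stripMatrix, Matrix.of_apply, Function.update_of_ne h]

/-- Pieri type recursion: a horizontal strip in rows `≥ i` either avoids row `i` or contains the
last cell of that row. -/
lemma stripDet_eq_add {q : ℝ} (h0 : 0 < q) (h1 : q ≠ 1) {k : ℕ} (l : Fin k → ℕ) (i : Fin k)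
    (hl : 0 < l i) :
    stripDet q l i = stripDet q l (i + 1) + stripDet q (Function.update l i (l i - 1)) i := by
  unfold stripDet
  rw [stripMatrix_eq_updateRow, stripMatrix_update_eq_updateRow]
  obtain ⟨m, hm⟩ : ∃ m, l i = m + 1 := ⟨l i - 1, by omega⟩
  have : (fun b : Fin k => qComplete q (l i) b)
      = (stripMatrix q l (i + 1)) i + (fun b : Fin k => qComplete q (l i - 1) b) := by
    ext b
    simp only [stripMatrix, Matrix.of_apply, Pi.add_apply, hm]
    rw [if_pos (by omega)]
    exact qComplete_succ h0 h1 m b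
  rw [this, Matrix.det_updateRow_add, Matrix.updateRow_eq_self]

lemma stripDet_eq_of_zero (q : ℝ) {k : ℕ} (l : Fin k → ℕ) (i : Fin k) (hl : l i = 0) :
    stripDet q l i = stripDet q l (i + 1) := by
  unfold stripDet
  congr 1
  ext a b
  by_cases h : a = i
  · subst h
    rcases Nat.eq_zero_or_pos (b : ℕ) with hb | hb
    · simp [stripMatrix, hl]
    · simp [stripMatrix, hl, qComplete, hb.ne']
  · rw [stripMatrix_succ_of_ne q l h]

lemma stripDet_update_eq_zero (q : ℝ) {k : ℕ} (l : Fin k → ℕ) (i j : Fin k)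
    (hij : (j : ℕ) = i + 1) (hl : l i = l j + 1) :
    stripDet q (Function.update l i (l i - 1)) i = 0 := by
  have hne : i ≠ j := fun e => by rw [e] at hij; omega
  refine Matrix.det_zero_of_row_eq hne ?_
  ext b
  have : ¬ (j : ℕ) < i := by omega
  simp only [stripMatrix, Matrix.of_apply, Function.update_self, Function.update_of_ne hne.symm,
    lt_irrefl, this, if_false, hl, Nat.add_sub_cancel]

/-- Homogeneity of the fully shifted determinant. -/
lemma stripDet_last (q : ℝ) {k : ℕ} (l : Fin k → ℕ) :
    q ^ (∑ b : Fin k, (b : ℕ)) * stripDet q l k = q ^ (∑ a, l a) * stripDet q l 0 := by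
  unfold stripDet
  rw [← prod_pow_eq_pow_sum, ← prod_pow_eq_pow_sum, ← Matrix.det_mul_row, ← Matrix.det_mul_column]
  congr 1
  ext a b
  simp only [stripMatrix, Matrix.of_apply, Fin.is_lt, if_true, Nat.not_lt_zero, if_false, one_mul]
  by_cases h : (b : ℕ) ≤ l a
  · rw [← mul_assoc, ← pow_add, Nat.add_sub_cancel' h]
  · simp [qComplete, h]

/-- Multiplying row `a` by `(q; q)_{l_a}` turns its entries into values at `q ^ l_a` of
polynomials, proportional to the monic polynomials `∏_{t < b} (X - q ^ t)`. -/
lemma qPoch_mul_qComplete {q : ℝ} (h0 : 0 < q) (h1 : q ≠ 1) (l b : ℕ) :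
    qPoch q l * qComplete q l b
      = (∏ t ∈ range b, (-(q ^ t)⁻¹)) * ∏ t ∈ range b, (q ^ l - q ^ t) := by
  rw [← prod_mul_distrib]
  have hq : ∀ t : ℕ, q ^ t ≠ 0 := fun t => (pow_pos h0 t).ne'
  by_cases h : b ≤ l
  · rw [qComplete, if_pos h]
    induction b with
    | zero => simp [qPoch_ne_zero h0 h1]
    | succ b ih =>
      rw [prod_range_succ, ← ih (by omega)]
      obtain ⟨m, rfl⟩ := Nat.exists_eq_add_of_le h
      have e1 : b + 1 + m - (b + 1) = m := by omega
      have e2 : b + 1 + m - b = m + 1 := by omega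
      rw [e1, e2, qPoch_succ]
      have := qPoch_ne_zero h0 h1 m
      have := one_sub_pow_ne_zero h0 h1 m.succ_ne_zero
      have := hq b
      field_simp
      ring
  · rw [qComplete, if_neg h, mul_zero, eq_comm]
    exact prod_eq_zero (mem_range.2 (not_le.1 h)) (by simp)

/-- Product formula for the principal specialization of Schur functions, up to a factor that
depends only on the number of rows. -/
lemma stripDet_zero {q : ℝ} (h0 : 0 < q) (h1 : q ≠ 1) {k : ℕ} (l : Fin k → ℕ) :
    (∏ a, qPoch q (l a)) * stripDet q l 0
      = (∏ b : Fin k, ∏ t ∈ range b, (-(q ^ t)⁻¹))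
          * ∏ a : Fin k, ∏ b ∈ Ioi a, (q ^ l b - q ^ l a) := by
  rw [← Matrix.det_vandermonde]
  rw [Matrix.det_eval_matrixOfPolynomials_eq_det_vandermonde (fun a => q ^ l a)
    (fun b => ∏ t ∈ range b, (Polynomial.X - Polynomial.C (q ^ t)))
    (fun b => by
      rw [Polynomial.natDegree_prod_of_monic _ _ fun t _ => Polynomial.monic_X_sub_C _]
      simp only [Polynomial.natDegree_X_sub_C, sum_const, card_range, smul_eq_mul, mul_one])
    (fun b => Polynomial.monic_prod_of_monic _ _ fun t _ => Polynomial.monic_X_sub_C _)]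
  unfold stripDet
  rw [← Matrix.det_mul_column, ← Matrix.det_mul_row]
  congr 1
  ext a b
  simp only [stripMatrix, Matrix.of_apply, Nat.not_lt_zero, if_false, one_mul,
    Polynomial.eval_prod, Polynomial.eval_sub, Polynomial.eval_X, Polynomial.eval_C]
  exact qPoch_mul_qComplete h0 h1 _ _

/-! ### Standard tableaux as fillings, and removal of the largest entry -/

/-- A filling of the cells of `μ` as a function on `ℕ × ℕ`, extended by `0`, that is a standard
tableau. In this form cells can be added and removed without transport along equalities. -/
structure IsStandardFilling (μ : YoungDiagram) (e : ℕ × ℕ → ℕ) : Prop where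
  eq_zero : ∀ c ∉ μ.cells, e c = 0
  bijOn : Set.BijOn e μ.cells (Finset.Icc 1 μ.card)
  row_strict : ∀ c ∈ μ.cells, ∀ d ∈ μ.cells, c.1 = d.1 → c.2 < d.2 → e c < e d
  col_strict : ∀ c ∈ μ.cells, ∀ d ∈ μ.cells, c.2 = d.2 → c.1 < d.1 → e c < e d

namespace StandardTableau

variable {μ : YoungDiagram}

/-- The filling underlying a standard tableau. -/
def toFilling (T : StandardTableau μ) (c : ℕ × ℕ) : ℕ :=
  if h : c ∈ μ.cells then T.entry ⟨c, h⟩ else 0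

lemma toFilling_of_mem (T : StandardTableau μ) {c : ℕ × ℕ} (h : c ∈ μ.cells) :
    T.toFilling c = T.entry ⟨c, h⟩ := dif_pos h

lemma toFilling_injective : Function.Injective (toFilling (μ := μ)) := by
  intro T U h
  obtain ⟨e, _, _⟩ := T
  obtain ⟨f, _, _⟩ := U
  have : e = f := by
    ext ⟨c, hc⟩
    have := congrFun h c
    rwa [toFilling_of_mem _ hc, toFilling_of_mem _ hc] at this
  subst this
  rfl

instance : Finite (StandardTableau μ) :=
  Finite.of_injective (fun T => T.entry) fun T U h => by
    obtain ⟨e, _, _⟩ := T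
    obtain ⟨f, _, _⟩ := U
    have : e = f := h
    subst this
    rfl

instance : Fintype (StandardTableau μ) := Fintype.ofFinite _

lemma isStandardFilling_toFilling (T : StandardTableau μ) : IsStandardFilling μ T.toFilling where
  eq_zero c hc := dif_neg hc
  bijOn := by
    refine ⟨fun c hc => ?_, fun c hc d hd h => ?_, fun k hk => ?_⟩
    · rw [toFilling_of_mem T hc]
      exact (T.entry ⟨c, hc⟩).2
    · rw [toFilling_of_mem T hc, toFilling_of_mem T hd] at h
      exact congrArg Subtype.val (T.entry.injective (Subtype.ext h))
    · refine ⟨(T.entry.symm ⟨k, hk⟩).1, (T.entry.symm ⟨k, hk⟩).2, ?_⟩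
      rw [toFilling_of_mem T (T.entry.symm ⟨k, hk⟩).2]
      simp
  row_strict c hc d hd := by
    rw [toFilling_of_mem T hc, toFilling_of_mem T hd]
    exact T.row_strict ⟨c, hc⟩ ⟨d, hd⟩
  col_strict c hc d hd := by
    rw [toFilling_of_mem T hc, toFilling_of_mem T hd]
    exact T.col_strict ⟨c, hc⟩ ⟨d, hd⟩

lemma exists_toFilling_eq {e : ℕ × ℕ → ℕ} (he : IsStandardFilling μ e) :
    ∃ T : StandardTableau μ, T.toFilling = e := by
  refine ⟨⟨he.bijOn.equiv e, fun c d => he.row_strict _ c.2 _ d.2,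
    fun c d => he.col_strict _ c.2 _ d.2⟩, ?_⟩
  ext c
  by_cases h : c ∈ μ.cells
  · rw [toFilling_of_mem _ h]
    rfl
  · rw [he.eq_zero c h]
    exact dif_neg h

end StandardTableau

namespace YoungDiagram

variable {μ : YoungDiagram}

/-- The finite set of standard fillings of `μ`. -/
def standardFillings (μ : YoungDiagram) : Finset (ℕ × ℕ → ℕ) :=
  univ.map ⟨StandardTableau.toFilling (μ := μ), StandardTableau.toFilling_injective⟩

lemma mem_standardFillings {e : ℕ × ℕ → ℕ} : e ∈ μ.standardFillings ↔ IsStandardFilling μ e := by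
  simp only [standardFillings, mem_map, mem_univ, true_and, Function.Embedding.coeFn_mk]
  exact ⟨fun ⟨T, hT⟩ => hT ▸ T.isStandardFilling_toFilling, StandardTableau.exists_toFilling_eq⟩

/-- Row `i` ends in a corner: it is longer than the next row. -/
def IsCornerRow (μ : YoungDiagram) (i : ℕ) : Prop := μ.rowLen (i + 1) < μ.rowLen i

/-- The last cell of row `i`. -/
def rowEnd (μ : YoungDiagram) (i : ℕ) : ℕ × ℕ := (i, μ.rowLen i - 1)

/-- The diagram without the cells weakly to the south-east of the last cell of row `i`. If row `i`
ends in a corner, exactly this corner is removed. -/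
def removeCorner (μ : YoungDiagram) (i : ℕ) : YoungDiagram where
  cells := μ.cells.filter fun c => ¬ (i ≤ c.1 ∧ μ.rowLen i - 1 ≤ c.2)
  isLowerSet := by
    intro c d hdc hc
    simp only [coe_filter, Set.mem_ofPred_eq] at hc ⊢
    exact ⟨μ.isLowerSet hdc hc.1,
      fun h => hc.2 ⟨h.1.trans hdc.1, h.2.trans hdc.2⟩⟩

lemma rowEnd_mem {i : ℕ} (h : μ.IsCornerRow i) : μ.rowEnd i ∈ μ.cells := by
  rw [mem_cells, rowEnd, mem_iff_lt_rowLen]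
  unfold IsCornerRow at h
  omega

lemma cells_removeCorner {i : ℕ} (h : μ.IsCornerRow i) :
    (μ.removeCorner i).cells = μ.cells.erase (μ.rowEnd i) := by
  ext ⟨a, b⟩
  simp only [removeCorner, mem_filter, mem_erase, rowEnd, ne_eq, Prod.mk.injEq]
  rw [and_comm]
  refine and_congr_left fun hm => not_congr ⟨fun hab => ?_, fun hab => ⟨hab.1.ge, hab.2.ge⟩⟩
  rw [mem_cells, mem_iff_lt_rowLen] at hm
  unfold IsCornerRow at h
  rcases eq_or_lt_of_le hab.1 with rfl | hlt
  · exact ⟨rfl, by omega⟩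
  · have := μ.rowLen_anti (i + 1) a hlt
    omega

lemma card_removeCorner {i : ℕ} (h : μ.IsCornerRow i) :
    (μ.removeCorner i).card + 1 = μ.card := by
  unfold YoungDiagram.card
  rw [cells_removeCorner h, card_erase_add_one (rowEnd_mem h)]

lemma rowLen_removeCorner {i : ℕ} (h : μ.IsCornerRow i) :
    (μ.removeCorner i).rowLen = Function.update μ.rowLen i (μ.rowLen i - 1) := by
  ext a
  refine eq_of_forall_lt_iff fun j => ?_
  rw [← mem_iff_lt_rowLen, ← mem_cells, cells_removeCorner h, mem_erase, mem_cells,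
    mem_iff_lt_rowLen, rowEnd, ne_eq, Prod.mk.injEq]
  unfold IsCornerRow at h
  by_cases ha : a = i
  · subst ha
    rw [Function.update_self]
    omega
  · rw [Function.update_of_ne ha]
    tauto

end YoungDiagram

open YoungDiagram

namespace IsStandardFilling

variable {μ : YoungDiagram} {e : ℕ × ℕ → ℕ}

lemma le_card (he : IsStandardFilling μ e) (c : ℕ × ℕ) : e c ≤ μ.card := by
  by_cases h : c ∈ μ.cells
  · exact (Finset.mem_Icc.1 (he.bijOn.mapsTo h)).2
  · rw [he.eq_zero c h]
    exact zero_le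

lemma pos (he : IsStandardFilling μ e) {c : ℕ × ℕ} (h : c ∈ μ.cells) : 0 < e c :=
  (Finset.mem_Icc.1 (he.bijOn.mapsTo h)).1

/-- Adding a cell with the largest entry in a corner. -/
lemma update_rowEnd {i : ℕ} (hi : μ.IsCornerRow i) (he : IsStandardFilling (μ.removeCorner i) e) :
    IsStandardFilling μ (Function.update e (μ.rowEnd i) μ.card) := by
  have hcells := cells_removeCorner hi
  have hcard := card_removeCorner hi
  have hmem : ∀ c ∈ μ.cells, c ≠ μ.rowEnd i → c ∈ (μ.removeCorner i).cells := fun c hc hne => by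
    rw [hcells]; exact mem_erase.2 ⟨hne, hc⟩
  have hend := rowEnd_mem hi
  have hlt : ∀ c, e c < μ.card := fun c => by have := he.le_card c; omega
  have hmax : ∀ d ∈ μ.cells, (μ.rowEnd i).1 ≤ d.1 → (μ.rowEnd i).2 ≤ d.2 → d = μ.rowEnd i := by
    intro d hd h1 h2
    by_contra hne
    have := hmem d hd hne
    simp only [removeCorner, mem_filter] at this
    exact this.2 ⟨h1, h2⟩
  refine ⟨fun c hc => ?_, ⟨fun c hc => ?_, fun c hc d hd h => ?_, fun k hk => ?_⟩, ?_, ?_⟩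
  · have hne : c ≠ μ.rowEnd i := fun h => hc (h ▸ hend)
    rw [Function.update_of_ne hne]
    exact he.eq_zero c fun h => hc (by rw [hcells] at h; exact mem_of_mem_erase h)
  · rw [Finset.coe_Icc, Set.mem_Icc]
    by_cases hne : c = μ.rowEnd i
    · subst hne
      rw [Function.update_self]
      omega
    · rw [Function.update_of_ne hne]
      exact ⟨he.pos (hmem c hc hne), (hlt c).le⟩
  · by_cases hc' : c = μ.rowEnd i <;> by_cases hd' : d = μ.rowEnd i
    · rw [hc', hd']
    · rw [hc', Function.update_self, Function.update_of_ne hd'] at h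
      exact absurd h (hlt d).ne'
    · rw [hd', Function.update_self, Function.update_of_ne hc'] at h
      exact absurd h (hlt c).ne
    · rw [Function.update_of_ne hc', Function.update_of_ne hd'] at h
      exact he.bijOn.injOn (hmem c hc hc') (hmem d hd hd') h
  · rw [Finset.coe_Icc, Set.mem_Icc] at hk
    rcases eq_or_lt_of_le hk.2 with rfl | hlt'
    · exact ⟨_, hend, Function.update_self _ _ _⟩
    · obtain ⟨c, hc, hck⟩ := he.bijOn.surjOn
        (show k ∈ ((Finset.Icc 1 (μ.removeCorner i).card : Finset ℕ) : Set ℕ) by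
          rw [Finset.coe_Icc, Set.mem_Icc]; omega)
      rw [mem_coe, hcells, mem_erase] at hc
      exact ⟨c, hc.2, by rw [Function.update_of_ne hc.1, hck]⟩
  · intro c hc d hd h1 h2
    by_cases hc' : c = μ.rowEnd i
    · subst hc'
      rw [hmax d hd h1.le h2.le] at h2
      exact absurd h2 (lt_irrefl _)
    · rw [Function.update_of_ne hc']
      by_cases hd' : d = μ.rowEnd i
      · rw [hd', Function.update_self]
        exact hlt c
      · rw [Function.update_of_ne hd']
        exact he.row_strict c (hmem c hc hc') d (hmem d hd hd') h1 h2
  · intro c hc d hd h1 h2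
    by_cases hc' : c = μ.rowEnd i
    · subst hc'
      rw [hmax d hd h2.le h1.le] at h2
      exact absurd h2 (lt_irrefl _)
    · rw [Function.update_of_ne hc']
      by_cases hd' : d = μ.rowEnd i
      · rw [hd', Function.update_self]
        exact hlt c
      · rw [Function.update_of_ne hd']
        exact he.col_strict c (hmem c hc hc') d (hmem d hd hd') h1 h2

/-- The largest entry lies in a corner. -/
lemma exists_isCornerRow (he : IsStandardFilling μ e) (hμ : 0 < μ.card) :
    ∃ i, μ.IsCornerRow i ∧ e (μ.rowEnd i) = μ.card := by
  obtain ⟨⟨i, j⟩, hc, hcn⟩ := he.bijOn.surjOn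
    (show μ.card ∈ ((Finset.Icc 1 μ.card : Finset ℕ) : Set ℕ) by
      rw [Finset.coe_Icc, Set.mem_Icc]; omega)
  have hij : j < μ.rowLen i := by rwa [← mem_iff_lt_rowLen, ← mem_cells]
  have hr : ¬ j + 1 < μ.rowLen i := by
    intro h
    rw [← mem_iff_lt_rowLen, ← mem_cells] at h
    have := he.row_strict _ hc _ h rfl (Nat.lt_succ_self j)
    have := he.le_card (i, j + 1)
    omega
  have hd : ¬ j < μ.rowLen (i + 1) := by
    intro h
    rw [← mem_iff_lt_rowLen, ← mem_cells] at h
    have := he.col_strict _ hc _ h rfl (Nat.lt_succ_self i)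
    have := he.le_card (i + 1, j)
    omega
  refine ⟨i, by unfold IsCornerRow; omega, ?_⟩
  have : μ.rowEnd i = (i, j) := by
    unfold rowEnd
    congr 1
    omega
  rw [this, hcn]

/-- Removing the cell with the largest entry. -/
lemma erase_rowEnd {i : ℕ} (hi : μ.IsCornerRow i) (he : IsStandardFilling μ e)
    (hen : e (μ.rowEnd i) = μ.card) :
    IsStandardFilling (μ.removeCorner i) (Function.update e (μ.rowEnd i) 0) := by
  have hcells := cells_removeCorner hi
  have hcard := card_removeCorner hi
  have hend := rowEnd_mem hi
  have hmem : ∀ c ∈ (μ.removeCorner i).cells, c ≠ μ.rowEnd i ∧ c ∈ μ.cells := fun c hc => by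
    rwa [hcells, mem_erase] at hc
  refine ⟨fun c hc => ?_, ⟨fun c hc => ?_, fun c hc d hd h => ?_, fun k hk => ?_⟩, ?_, ?_⟩
  · by_cases hne : c = μ.rowEnd i
    · rw [hne, Function.update_self]
    · rw [Function.update_of_ne hne]
      exact he.eq_zero c fun h => hc (by rw [hcells]; exact mem_erase.2 ⟨hne, h⟩)
  · obtain ⟨hne, hc⟩ := hmem c hc
    rw [Finset.coe_Icc, Set.mem_Icc, Function.update_of_ne hne]
    have h1 := he.pos hc
    have h2 := he.le_card c
    have h3 : e c ≠ μ.card := fun h => hne (he.bijOn.injOn hc hend (h.trans hen.symm))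
    omega
  · obtain ⟨hc', hc⟩ := hmem c hc
    obtain ⟨hd', hd⟩ := hmem d hd
    rw [Function.update_of_ne hc', Function.update_of_ne hd'] at h
    exact he.bijOn.injOn hc hd h
  · rw [Finset.coe_Icc, Set.mem_Icc] at hk
    obtain ⟨c, hc, hck⟩ := he.bijOn.surjOn
      (show k ∈ ((Finset.Icc 1 μ.card : Finset ℕ) : Set ℕ) by
        rw [Finset.coe_Icc, Set.mem_Icc]; omega)
    have hne : c ≠ μ.rowEnd i := fun h => by rw [h] at hck; omega
    exact ⟨c, by rw [mem_coe, hcells]; exact mem_erase.2 ⟨hne, hc⟩,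
      by rw [Function.update_of_ne hne, hck]⟩
  · intro c hc d hd h1 h2
    obtain ⟨hc', hc⟩ := hmem c hc
    obtain ⟨hd', hd⟩ := hmem d hd
    rw [Function.update_of_ne hc', Function.update_of_ne hd']
    exact he.row_strict c hc d hd h1 h2
  · intro c hc d hd h1 h2
    obtain ⟨hc', hc⟩ := hmem c hc
    obtain ⟨hd', hd⟩ := hmem d hd
    rw [Function.update_of_ne hc', Function.update_of_ne hd']
    exact he.col_strict c hc d hd h1 h2

end IsStandardFilling

namespace YoungDiagram

variable {μ : YoungDiagram}

open Classical in
/-- Summation over standard fillings according to the position of the largest entry. -/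
lemma sum_standardFillings (hμ : 0 < μ.card) {k : ℕ} (hk : μ.rowLen k = 0)
    (f : (ℕ × ℕ → ℕ) → ℝ) :
    ∑ e ∈ μ.standardFillings, f e
      = ∑ i ∈ range k with μ.IsCornerRow i, ∑ e ∈ (μ.removeCorner i).standardFillings,
          f (Function.update e (μ.rowEnd i) μ.card) := by
  rw [sum_sigma', eq_comm]
  refine sum_bij (fun p _ => Function.update p.2 (μ.rowEnd p.1) μ.card) ?_ ?_ ?_ (fun _ _ => rfl)
  · rintro ⟨i, e⟩ hp
    simp only [mem_sigma, mem_filter] at hp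
    exact mem_standardFillings.2 ((mem_standardFillings.1 hp.2).update_rowEnd hp.1.2)
  · rintro ⟨i, e⟩ hp ⟨j, f⟩ hq h
    simp only [mem_sigma, mem_filter] at hp hq h
    have he := mem_standardFillings.1 hp.2
    have hf := mem_standardFillings.1 hq.2
    have hci := card_removeCorner hp.1.2
    have hcj := card_removeCorner hq.1.2
    have hij : μ.rowEnd i = μ.rowEnd j := by
      by_contra hne
      have := congrFun h (μ.rowEnd i)
      rw [Function.update_self, Function.update_of_ne hne] at this
      have := hf.le_card (μ.rowEnd i)
      omega
    obtain rfl : i = j := congrArg Prod.fst hij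
    congr 1
    ext c
    by_cases hc : c = μ.rowEnd i
    · have hn : μ.rowEnd i ∉ (μ.removeCorner i).cells := by
        rw [cells_removeCorner hp.1.2]; exact notMem_erase _ _
      rw [hc, he.eq_zero _ hn, hf.eq_zero _ hn]
    · have := congrFun h c
      rwa [Function.update_of_ne hc, Function.update_of_ne hc] at this
  · intro e he
    have he := mem_standardFillings.1 he
    obtain ⟨i, hi, hen⟩ := he.exists_isCornerRow hμ
    refine ⟨⟨i, Function.update e (μ.rowEnd i) 0⟩, ?_, ?_⟩
    · simp only [mem_sigma, mem_filter, mem_range]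
      refine ⟨⟨?_, hi⟩, mem_standardFillings.2 (he.erase_rowEnd hi hen)⟩
      by_contra hki
      have := μ.rowLen_anti k i (not_lt.1 hki)
      unfold IsCornerRow at hi
      omega
    · simp [← hen]

/-- The entry `j + 1` of the filling `e` lies in a row of larger index than the entry `j`. -/
def IsFillingDescent (μ : YoungDiagram) (e : ℕ × ℕ → ℕ) (j : ℕ) : Prop :=
  ∃ c ∈ μ.cells, ∃ d ∈ μ.cells, e c = j ∧ e d = j + 1 ∧ c.1 < d.1

open Classical in
/-- The major index of the sequence of rows of a filling, followed by the row index `i`: the sum of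
the descents, augmented by `|μ|` if the largest entry lies in a row of index `< i`. -/
def extendedMaj (μ : YoungDiagram) (e : ℕ × ℕ → ℕ) (i : ℕ) : ℕ :=
  (∑ j ∈ range μ.card, if μ.IsFillingDescent e j then j else 0)
    + if ∃ c ∈ μ.cells, e c = μ.card ∧ c.1 < i then μ.card else 0

lemma extendedMaj_toFilling_zero (T : StandardTableau μ) :
    μ.extendedMaj T.toFilling 0 = T.maj := by
  classical
  have hd : ∀ j, μ.IsFillingDescent T.toFilling j ↔ T.IsDescent j := by
    intro j
    constructor
    · rintro ⟨c, hc, d, hd, h⟩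
      rw [T.toFilling_of_mem hc, T.toFilling_of_mem hd] at h
      exact ⟨⟨c, hc⟩, ⟨d, hd⟩, h⟩
    · rintro ⟨⟨c, hc⟩, ⟨d, hd⟩, h⟩
      rw [← T.toFilling_of_mem hc, ← T.toFilling_of_mem hd] at h
      exact ⟨c, hc, d, hd, h⟩
  unfold extendedMaj StandardTableau.maj
  simp only [Nat.not_lt_zero, and_false, exists_false, if_false, add_zero, hd]
  rw [sum_filter, eq_comm]
  refine sum_subset_zero_on_sdiff (fun j hj => ?_) (fun j hj => ?_) fun j _ => ?_
  · rw [mem_Icc] at hj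
    rw [mem_range]
    omega
  · rw [mem_sdiff, mem_range, mem_Icc] at hj
    have : j = 0 := by omega
    simp [this]
  · congr 

lemma extendedMaj_update {i : ℕ} (hi : μ.IsCornerRow i) {e : ℕ × ℕ → ℕ}
    (he : IsStandardFilling (μ.removeCorner i) e) (i' : ℕ) :
    μ.extendedMaj (Function.update e (μ.rowEnd i) μ.card) i'
      = (μ.removeCorner i).extendedMaj e i + if i < i' then μ.card else 0 := by
  have hcells := cells_removeCorner hi
  have hcard := card_removeCorner hi
  have hend := rowEnd_mem hi
  have hmem : ∀ c, c ∈ (μ.removeCorner i).cells ↔ c ≠ μ.rowEnd i ∧ c ∈ μ.cells := fun c => by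
    rw [hcells, mem_erase]
  set f := Function.update e (μ.rowEnd i) μ.card with hf
  have hfe : f (μ.rowEnd i) = μ.card := Function.update_self _ _ _
  have hfn : ∀ c, c ≠ μ.rowEnd i → f c = e c := fun c hc => Function.update_of_ne hc _ _
  have hlt : ∀ c, e c < μ.card := fun c => by have := he.le_card c; omega
  have hfc : ∀ c, f c = μ.card ↔ c = μ.rowEnd i := fun c => by
    refine ⟨fun h => ?_, fun h => h ▸ hfe⟩
    by_contra hne
    rw [hfn c hne] at h
    exact (hlt c).ne h
  have h1 : ∀ j < (μ.removeCorner i).card,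
      (μ.IsFillingDescent f j ↔ (μ.removeCorner i).IsFillingDescent e j) := by
    intro j hj
    constructor
    · rintro ⟨c, hc, d, hd, h1, h2, h3⟩
      have hc' : c ≠ μ.rowEnd i := fun h => by rw [h] at h1; omega
      have hd' : d ≠ μ.rowEnd i := fun h => by rw [h] at h2; omega
      exact ⟨c, (hmem c).2 ⟨hc', hc⟩, d, (hmem d).2 ⟨hd', hd⟩, by rw [← hfn c hc', h1],
        by rw [← hfn d hd', h2], h3⟩
    · rintro ⟨c, hc, d, hd, h1, h2, h3⟩
      rw [hmem] at hc hd
      exact ⟨c, hc.2, d, hd.2, by rw [hfn c hc.1, h1], by rw [hfn d hd.1, h2], h3⟩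
  have h2 : μ.IsFillingDescent f (μ.removeCorner i).card
      ↔ ∃ c ∈ (μ.removeCorner i).cells, e c = (μ.removeCorner i).card ∧ c.1 < i := by
    constructor
    · rintro ⟨c, hc, d, hd, h1, h2, h3⟩
      have hc' : c ≠ μ.rowEnd i := fun h => by rw [h] at h1; omega
      rw [hcard, hfc] at h2
      subst h2
      exact ⟨c, (hmem c).2 ⟨hc', hc⟩, by rw [← hfn c hc', h1], h3⟩
    · rintro ⟨c, hc, h1, h3⟩
      rw [hmem] at hc
      exact ⟨c, hc.2, μ.rowEnd i, hend, by rw [hfn c hc.1, h1], by rw [hfe, hcard], h3⟩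
  have h3 : (∃ c ∈ μ.cells, f c = μ.card ∧ c.1 < i') ↔ i < i' := by
    constructor
    · rintro ⟨c, _, h1, h2⟩
      rw [hfc] at h1
      subst h1
      exact h2
    · exact fun h => ⟨_, hend, hfe, h⟩
  unfold extendedMaj
  simp only [h3]
  congr 1
  rw [← hcard, sum_range_succ]
  simp only [h2]
  congr 1
  refine sum_congr rfl fun j hj => ?_
  classical exact if_congr (h1 j (mem_range.1 hj)) rfl rfl

/-- The generating function of `extendedMaj` over the standard tableaux of shape `μ`. -/
def majGen (q : ℝ) (μ : YoungDiagram) (i : ℕ) : ℝ :=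
  ∑ e ∈ μ.standardFillings, q ^ μ.extendedMaj e i

lemma sum_pow_maj (q : ℝ) (μ : YoungDiagram) :
    ∑ T : StandardTableau μ, q ^ T.maj = majGen q μ 0 := by
  unfold majGen standardFillings
  rw [sum_map]
  exact sum_congr rfl fun T _ => by rw [← extendedMaj_toFilling_zero]; rfl

open Classical in
lemma majGen_eq_sum (q : ℝ) (hμ : 0 < μ.card) {k : ℕ} (hk : μ.rowLen k = 0) (i : ℕ) :
    majGen q μ i = ∑ j ∈ range k with μ.IsCornerRow j,
      (if j < i then q ^ μ.card else 1) * majGen q (μ.removeCorner j) j := by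
  unfold majGen
  rw [sum_standardFillings hμ hk]
  refine sum_congr rfl fun j hj => ?_
  rw [mul_sum]
  refine sum_congr rfl fun e he => ?_
  rw [extendedMaj_update (mem_filter.1 hj).2 (mem_standardFillings.1 he), pow_add, mul_comm]
  split_ifs <;> simp

end YoungDiagram

/-! ### The generating function of the major index -/

namespace YoungDiagram

variable {μ : YoungDiagram}

/-- The strictly decreasing sequence `l_a = μ_a + k - 1 - a` attached to the first `k` rows. -/
def shiftedRow (μ : YoungDiagram) (k : ℕ) (a : Fin k) : ℕ := μ.rowLen a + (k - 1 - a)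

lemma shiftedRow_removeCorner {k : ℕ} (i : Fin k) (h : μ.IsCornerRow i) :
    (μ.removeCorner i).shiftedRow k
      = Function.update (μ.shiftedRow k) i (μ.shiftedRow k i - 1) := by
  ext a
  unfold shiftedRow
  rw [rowLen_removeCorner h]
  unfold IsCornerRow at h
  by_cases ha : a = i
  · subst ha
    rw [Function.update_self, Function.update_self]
    omega
  · rw [Function.update_of_ne ha, Function.update_of_ne fun e => ha (Fin.ext e)]

lemma shiftedRow_strictAnti (μ : YoungDiagram) (k : ℕ) : StrictAnti (μ.shiftedRow k) := by
  intro a b hab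
  have h1 : (a : ℕ) < b := hab
  have := μ.rowLen_anti a b h1.le
  unfold shiftedRow
  omega

lemma sum_rowLen {k : ℕ} (hk : μ.rowLen k = 0) : ∑ i ∈ range k, μ.rowLen i = μ.card := by
  unfold YoungDiagram.card
  rw [card_eq_sum_card_fiberwise (f := Prod.fst) (t := range k) (fun c hc => ?_)]
  · exact sum_congr rfl fun i _ => μ.rowLen_eq_card
  · rw [mem_coe, mem_range]
    by_contra h
    have h1 := μ.rowLen_anti k c.1 (not_lt.1 h)
    have h2 : c.2 < μ.rowLen c.1 := by rw [← mem_iff_lt_rowLen]; exact hc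
    omega

lemma sum_shiftedRow {k : ℕ} (hk : μ.rowLen k = 0) :
    ∑ a, μ.shiftedRow k a = μ.card + ∑ a : Fin k, (k - 1 - (a : ℕ)) := by
  unfold shiftedRow
  rw [sum_add_distrib, ← sum_rowLen hk, Finset.sum_range]

lemma sum_fin_sub (k : ℕ) : ∑ a : Fin k, (k - 1 - (a : ℕ)) = ∑ b : Fin k, (b : ℕ) := by
  rw [Fin.sum_univ_eq_sum_range (fun a => k - 1 - a), Fin.sum_univ_eq_sum_range (fun a => a)]
  exact Finset.sum_range_reflect (fun a => a) k

/-- The determinants of a diagram satisfy the recursion of horizontal strips. -/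
lemma stripDet_sub_stripDet {q : ℝ} (h0 : 0 < q) (h1 : q ≠ 1) {k : ℕ} (hk : μ.rowLen k = 0)
    (i : Fin k) [Decidable (μ.IsCornerRow i)] :
    stripDet q (μ.shiftedRow k) i - stripDet q (μ.shiftedRow k) (i + 1)
      = if μ.IsCornerRow i then stripDet q ((μ.removeCorner i).shiftedRow k) i else 0 := by
  have hi := i.2
  split_ifs with h
  · rw [shiftedRow_removeCorner i h, stripDet_eq_add h0 h1, add_sub_cancel_left]
    unfold IsCornerRow at h
    unfold shiftedRow
    omega
  · have hle := μ.rowLen_anti i (i + 1) (Nat.le_succ _)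
    have heq : μ.rowLen (i + 1) = μ.rowLen i := by unfold IsCornerRow at h; omega
    by_cases hlast : (i : ℕ) + 1 = k
    · rw [stripDet_eq_of_zero, sub_self]
      rw [hlast, hk] at heq
      unfold shiftedRow
      omega
    · have hl : μ.shiftedRow k i = μ.shiftedRow k ⟨i + 1, by omega⟩ + 1 := by
        simp only [shiftedRow, heq]
        omega
      rw [stripDet_eq_add h0 h1 _ i (by omega),
        stripDet_update_eq_zero q _ i ⟨i + 1, by omega⟩ rfl hl, add_zero, sub_self]

lemma stripDet_card {q : ℝ} (h0 : 0 < q) {k : ℕ} (hk : μ.rowLen k = 0) :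
    stripDet q (μ.shiftedRow k) k = q ^ μ.card * stripDet q (μ.shiftedRow k) 0 := by
  have := stripDet_last q (μ.shiftedRow k)
  rw [sum_shiftedRow hk, sum_fin_sub, pow_add, mul_comm (q ^ μ.card), mul_assoc] at this
  exact mul_left_cancel₀ (pow_pos h0 _).ne' this

lemma eq_bot_of_card_eq_zero (h : μ.card = 0) : μ = ⊥ :=
  YoungDiagram.ext (card_eq_zero.1 h)

lemma rowLen_bot (i : ℕ) : (⊥ : YoungDiagram).rowLen i = 0 := by
  by_contra h
  have : (i, 0) ∈ (⊥ : YoungDiagram) := mem_iff_lt_rowLen.2 (Nat.pos_of_ne_zero h)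
  exact notMem_bot _ this

lemma majGen_bot (q : ℝ) (i : ℕ) : majGen q ⊥ i = 1 := by
  have : (⊥ : YoungDiagram).standardFillings = {fun _ => 0} := by
    ext e
    rw [mem_standardFillings, mem_singleton]
    constructor
    · intro h
      ext c
      exact h.eq_zero c (notMem_bot c)
    · rintro rfl
      exact ⟨fun _ _ => rfl, by simp [YoungDiagram.card], fun c hc => absurd hc (notMem_bot c),
        fun c hc => absurd hc (notMem_bot c)⟩
  unfold majGen
  rw [this, sum_singleton]
  simp [extendedMaj, YoungDiagram.card]

lemma stripDet_bot {q : ℝ} (h0 : 0 < q) (h1 : q ≠ 1) (k : ℕ) {i : ℕ} (hi : i ≤ k) :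
    stripDet q ((⊥ : YoungDiagram).shiftedRow k) i
      = stripDet q ((⊥ : YoungDiagram).shiftedRow k) 0 := by
  classical
  induction i with
  | zero => rfl
  | succ i ih =>
    have := stripDet_sub_stripDet h0 h1 (rowLen_bot k) ⟨i, hi⟩
    rw [if_neg (by simp [IsCornerRow, rowLen_bot]), sub_eq_zero] at this
    rw [← ih (by omega)]
    exact this.symm

/-- Both sides satisfy the same recursion on the number of cells: on the left the largest entry is
removed, on the right a difference of determinants telescopes. -/
theorem majGen_mul_stripDet {q : ℝ} (h0 : 0 < q) (h1 : q ≠ 1) (k : ℕ) (n : ℕ) :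
    ∀ μ : YoungDiagram, μ.card = n → μ.rowLen k = 0 → ∀ i ≤ k,
      majGen q μ i * stripDet q ((⊥ : YoungDiagram).shiftedRow k) 0
        = qPoch q n * stripDet q (μ.shiftedRow k) i := by
  classical
  induction n with
  | zero =>
    intro μ hμ _ i hi
    rw [eq_bot_of_card_eq_zero hμ, majGen_bot, stripDet_bot h0 h1 k hi]
    simp [qPoch]
  | succ n ih =>
    intro μ hμ hk i hi
    rw [majGen_eq_sum q (by omega) hk, sum_mul, sum_filter]
    set D := stripDet q (μ.shiftedRow k) with hD
    have hterm : ∀ j ∈ range k, (if μ.IsCornerRow j then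
        (if j < i then q ^ μ.card else 1) * majGen q (μ.removeCorner j) j
          * stripDet q ((⊥ : YoungDiagram).shiftedRow k) 0 else 0)
        = qPoch q n * ((if j < i then q ^ μ.card else 1) * (D j - D (j + 1))) := by
      intro j hj
      have := stripDet_sub_stripDet h0 h1 hk ⟨j, mem_range.1 hj⟩
      simp only at this
      rw [hD, this]
      by_cases hc : μ.IsCornerRow j
      · have hr : (μ.removeCorner j).rowLen k = 0 := by
          rw [rowLen_removeCorner hc, Function.update_of_ne (mem_range.1 hj).ne', hk]
        rw [if_pos hc, if_pos hc, mul_assoc,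
          ih _ (by have := card_removeCorner hc; omega) hr j (mem_range.1 hj).le]
        ring
      · rw [if_neg hc, if_neg hc]
        ring
    rw [sum_congr rfl hterm, ← mul_sum, qPoch_succ, mul_assoc]
    congr 1
    have hlast : D k = q ^ μ.card * D 0 := stripDet_card h0 hk
    have htel : ∀ m, ∑ j ∈ range m, (D j - D (j + 1)) = D 0 - D m := fun m =>
      Finset.sum_range_sub' D m
    have hsplit : ∑ j ∈ range k, (if j < i then q ^ μ.card else 1) * (D j - D (j + 1))
        = q ^ μ.card * (D 0 - D i) + (D i - D k) := by
      rw [← htel i, mul_sum, ← sum_range_add_sum_Ico _ hi]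
      congr 1
      · exact sum_congr rfl fun j hj => by rw [if_pos (mem_range.1 hj)]
      · have := sum_range_add_sum_Ico (fun j => D j - D (j + 1)) hi
        rw [htel, htel] at this
        rw [sum_congr rfl fun j hj => by
          rw [if_neg (not_lt.2 (mem_Ico.1 hj).1), one_mul]]
        linarith
    rw [hsplit, hlast, ← hμ]
    ring

/-- The product formula for the generating function of the major index (Stanley's `q`-analogue of
the hook length formula), in cross-multiplied form and written with the shifted row lengths of
`μ` and of the empty diagram. -/
theorem sum_pow_maj_mul {q : ℝ} (h0 : 0 < q) (h1 : q ≠ 1) {k : ℕ} (hk : μ.rowLen k = 0) :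
    (∑ T : StandardTableau μ, q ^ T.maj)
        * (∏ a : Fin k, ∏ b ∈ Ioi a,
            (q ^ (⊥ : YoungDiagram).shiftedRow k b - q ^ (⊥ : YoungDiagram).shiftedRow k a))
        * ∏ a, qPoch q (μ.shiftedRow k a)
      = qPoch q μ.card * (∏ a : Fin k, ∏ b ∈ Ioi a, (q ^ μ.shiftedRow k b - q ^ μ.shiftedRow k a))
        * ∏ a, qPoch q ((⊥ : YoungDiagram).shiftedRow k a) := by
  have hmain := majGen_mul_stripDet h0 h1 k μ.card μ rfl hk 0 (zero_le)
  have e1 := stripDet_zero h0 h1 (μ.shiftedRow k)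
  have e2 := stripDet_zero h0 h1 ((⊥ : YoungDiagram).shiftedRow k)
  rw [← sum_pow_maj] at hmain
  have hC : (∏ b : Fin k, ∏ t ∈ range b, (-(q ^ t)⁻¹)) ≠ 0 :=
    prod_ne_zero_iff.2 fun b _ => prod_ne_zero_iff.2 fun t _ =>
      neg_ne_zero.2 (inv_ne_zero (pow_pos h0 t).ne')
  refine mul_left_cancel₀ hC ?_
  generalize (∏ b : Fin k, ∏ t ∈ range b, (-(q ^ t)⁻¹)) = C at *
  generalize (∏ a : Fin k, ∏ b ∈ Ioi a, (q ^ μ.shiftedRow k b - q ^ μ.shiftedRow k a)) = V at *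
  generalize (∏ a : Fin k, ∏ b ∈ Ioi a,
    (q ^ (⊥ : YoungDiagram).shiftedRow k b - q ^ (⊥ : YoungDiagram).shiftedRow k a)) = V0 at *
  linear_combination (∏ a, qPoch q (μ.shiftedRow k a))
      * (∏ a, qPoch q ((⊥ : YoungDiagram).shiftedRow k a)) * hmain
    - (∑ T : StandardTableau μ, q ^ T.maj) * (∏ a, qPoch q (μ.shiftedRow k a)) * e2
    + qPoch q μ.card * (∏ a, qPoch q ((⊥ : YoungDiagram).shiftedRow k a)) * e1

end YoungDiagram

/-! ### Cumulants of the major index -/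

/-- The entire function `z ↦ (exp z - 1) / z`, with value `1` at `0`. -/
def expDiv : ℝ → ℝ := dslope Real.exp 0

lemma mul_expDiv (z : ℝ) : z * expDiv z = Real.exp z - 1 := by
  simpa [expDiv] using sub_smul_dslope Real.exp 0 z

lemma expDiv_zero : expDiv 0 = 1 := by simp [expDiv]

lemma expDiv_pos (z : ℝ) : 0 < expDiv z := by
  have h := mul_expDiv z
  rcases lt_trichotomy z 0 with hz | rfl | hz
  · have := Real.exp_lt_one_iff.2 hz
    nlinarith
  · rw [expDiv_zero]
    exact one_pos
  · have := Real.one_lt_exp_iff.2 hz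
    nlinarith

lemma contDiff_expDiv {n : WithTop ℕ∞} : ContDiff ℝ n expDiv := by
  rw [contDiff_iff_contDiffAt]
  intro z
  by_cases hz : z = 0
  · subst hz
    obtain ⟨p, hp⟩ := analyticAt_rexp (x := (0 : ℝ))
    exact AnalyticAt.contDiffAt ⟨_, hp.has_fpower_series_dslope_fslope⟩
  · have h1 : ContDiffAt ℝ n (fun x : ℝ => (Real.exp x - 1) / x) z :=
      (Real.contDiff_exp.contDiffAt.sub contDiffAt_const).div contDiffAt_id hz
    refine h1.congr_of_eventuallyEq ?_
    filter_upwards [isOpen_ne.mem_nhds hz] with x hx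
    rw [eq_div_iff hx, mul_comm, mul_expDiv]

lemma iteratedDeriv_id_mul {f : ℝ → ℝ} (m : ℕ) (hf : ContDiff ℝ m f) :
    iteratedDeriv m (fun z => z * f z) 0 = m * iteratedDeriv (m - 1) f 0 := by
  rw [iteratedDeriv_fun_mul contDiffAt_fun_id hf.contDiffAt]
  rcases m with _ | m
  · simp
  · rw [sum_eq_single 1]
    · simp [iteratedDeriv_fun_id_zero]
    · intro i _ hi
      simp [iteratedDeriv_fun_id_zero, hi]
    · intro h
      exact absurd (mem_range.2 (by omega)) h

lemma iteratedDeriv_exp_zero (m : ℕ) : iteratedDeriv m Real.exp 0 = 1 := by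
  rw [iteratedDeriv_eq_iterate, Real.iter_deriv_exp, Real.exp_zero]

lemma iteratedDeriv_expDiv_zero (m : ℕ) : iteratedDeriv m expDiv 0 = 1 / (m + 1) := by
  have h := iteratedDeriv_id_mul (m + 1) (contDiff_expDiv (n := ((m + 1 : ℕ) : WithTop ℕ∞)))
  simp only [mul_expDiv] at h
  have h' : iteratedDeriv (m + 1) (fun z => Real.exp z - 1) 0 = 1 := by
    have := iteratedDeriv_const_add (𝕜 := ℝ) (F := ℝ) (n := m + 1) (x := 0) (f := Real.exp)
      (Nat.succ_pos m) (-1)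
    rw [iteratedDeriv_exp_zero] at this
    simpa [sub_eq_neg_add] using this
  rw [h', Nat.add_sub_cancel] at h
  push_cast at h
  rw [eq_div_iff (by positivity), mul_comm]
  exact h.symm

/-- The function `z ↦ log ((exp z - 1) / z)`. -/
def logExpDiv (z : ℝ) : ℝ := Real.log (expDiv z)

lemma contDiff_logExpDiv {n : WithTop ℕ∞} : ContDiff ℝ n logExpDiv :=
  contDiff_expDiv.log fun z => (expDiv_pos z).ne'

/-- For `φ z = (exp z - 1) / z` and `g = log φ`, differentiation of `z φ z = exp z - 1` gives
`φ z * (z g' z + 1) = exp z`. -/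
lemma expDiv_mul (z : ℝ) : expDiv z * (z * deriv logExpDiv z + 1) = Real.exp z := by
  have hd : HasDerivAt expDiv (deriv expDiv z) z :=
    ((contDiff_expDiv (n := 1)).differentiable one_ne_zero z).hasDerivAt
  have h1 : deriv logExpDiv z = deriv expDiv z / expDiv z := (hd.log (expDiv_pos z).ne').deriv
  have h2 : HasDerivAt (fun z => z * expDiv z) (1 * expDiv z + z * deriv expDiv z) z :=
    (hasDerivAt_id z).mul hd
  have h3 : HasDerivAt (fun z => z * expDiv z) (Real.exp z) z := by
    have : (fun z => z * expDiv z) = fun z => Real.exp z - 1 := funext mul_expDiv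
    rw [this]
    exact (Real.hasDerivAt_exp z).sub_const 1
  have h4 := h2.unique h3
  have := (expDiv_pos z).ne'
  rw [h1]
  field_simp
  linarith

/-- The Taylor coefficients at `0` of `z g' z + 1 = z / (1 - exp (-z))` satisfy the defining
recursion of the Bernoulli numbers. -/
lemma iteratedDeriv_mul_deriv_logExpDiv (m : ℕ) :
    iteratedDeriv m (fun z => z * deriv logExpDiv z + 1) 0 = (bernoulli' m : ℝ) := by
  have hdg : ∀ n : ℕ, ContDiff ℝ n (deriv logExpDiv) := fun n =>
    ((contDiff_succ_iff_deriv (n := n)).1 (contDiff_logExpDiv (n := n + 1))).2.2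
  have hu : ∀ n : ℕ, ContDiff ℝ n (fun z => z * deriv logExpDiv z + 1) := fun n =>
    (contDiff_id.mul (hdg n)).add contDiff_const
  induction m using Nat.strong_induction_on with
  | _ m ih =>
    have h1 : iteratedDeriv m (fun z => (z * deriv logExpDiv z + 1) * expDiv z) 0 = 1 := by
      have : (fun z => (z * deriv logExpDiv z + 1) * expDiv z) = Real.exp := by
        ext z
        rw [mul_comm, expDiv_mul]
      rw [this, iteratedDeriv_exp_zero]
    rw [iteratedDeriv_fun_mul (hu m).contDiffAt contDiff_expDiv.contDiffAt, sum_range_succ] at h1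
    have h2 : ((∑ k ∈ range m.succ, (m.choose (m - k) : ℚ) / (m - k + 1) * bernoulli' k : ℚ) : ℝ)
        = 1 := by rw [bernoulli'_spec, Rat.cast_one]
    rw [sum_range_succ] at h2
    push_cast at h2
    rw [sum_congr rfl fun i hi => by
      rw [ih i (mem_range.1 hi), iteratedDeriv_expDiv_zero, Nat.cast_sub (mem_range.1 hi).le]] at h1
    rw [sum_congr rfl fun i hi => by rw [Nat.choose_symm (mem_range.1 hi).le]] at h2
    simp only [Nat.choose_self, Nat.sub_self, iteratedDeriv_expDiv_zero,
      Nat.choose_zero_right] at h1 h2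
    have h3 : ∀ i ∈ range m, (m.choose i : ℝ) * (bernoulli' i : ℝ) * (1 / ((m : ℝ) - i + 1))
        = (m.choose i : ℝ) / ((m : ℝ) - i + 1) * (bernoulli' i : ℝ) := fun i _ => by ring
    rw [sum_congr rfl h3] at h1
    norm_num at h1 h2
    linarith

/-- The Taylor coefficients of `log ((exp z - 1) / z)`, which up to the linear term is the function
whose values at the multiples of `z` make up the cumulant generating function. -/
lemma iteratedDeriv_logExpDiv_zero {r : ℕ} (hr : 1 ≤ r) :
    iteratedDeriv r logExpDiv 0 = (bernoulli' r : ℝ) / r := by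
  obtain ⟨m, rfl⟩ : ∃ m, r = m + 1 := ⟨r - 1, by omega⟩
  have hdg : ContDiff ℝ (m + 1 : ℕ) (deriv logExpDiv) :=
    ((contDiff_succ_iff_deriv (n := (m + 1 : ℕ))).1 contDiff_logExpDiv).2.2
  have h := iteratedDeriv_mul_deriv_logExpDiv (m + 1)
  have h' : (fun z => z * deriv logExpDiv z + 1) = fun z => 1 + z * deriv logExpDiv z := by
    ext z; ring
  rw [h', iteratedDeriv_const_add (Nat.succ_pos m), iteratedDeriv_id_mul _ hdg, Nat.add_sub_cancel,
    ← iteratedDeriv_succ'] at h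
  rw [eq_div_iff (by positivity), mul_comm]
  exact h

/-- `f` is `r` times continuously differentiable and its `r`-th derivative at `0` is `v`. -/
structure HasIteratedDerivZero (r : ℕ) (f : ℝ → ℝ) (v : ℝ) : Prop where
  contDiff : ContDiff ℝ r f
  eq : iteratedDeriv r f 0 = v

namespace HasIteratedDerivZero

variable {r : ℕ} {f g : ℝ → ℝ} {v w : ℝ}

lemma add (hf : HasIteratedDerivZero r f v) (hg : HasIteratedDerivZero r g w) :
    HasIteratedDerivZero r (fun z => f z + g z) (v + w) :=
  ⟨hf.contDiff.add hg.contDiff, by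
    rw [iteratedDeriv_fun_add hf.contDiff.contDiffAt hg.contDiff.contDiffAt, hf.eq, hg.eq]⟩

lemma sub (hf : HasIteratedDerivZero r f v) (hg : HasIteratedDerivZero r g w) :
    HasIteratedDerivZero r (fun z => f z - g z) (v - w) :=
  ⟨hf.contDiff.sub hg.contDiff, by
    rw [iteratedDeriv_fun_sub hf.contDiff.contDiffAt hg.contDiff.contDiffAt, hf.eq, hg.eq]⟩

lemma sum {ι : Type*} {s : Finset ι} {F : ι → ℝ → ℝ} {V : ι → ℝ}
    (h : ∀ i ∈ s, HasIteratedDerivZero r (F i) (V i)) :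
    HasIteratedDerivZero r (fun z => ∑ i ∈ s, F i z) (∑ i ∈ s, V i) :=
  ⟨ContDiff.sum fun i hi => (h i hi).contDiff, by
    rw [iteratedDeriv_fun_sum fun i hi => (h i hi).contDiff.contDiffAt]
    exact sum_congr rfl fun i hi => (h i hi).eq⟩

lemma affine (hr : 2 ≤ r) (a b : ℝ) : HasIteratedDerivZero r (fun z => a + b * z) 0 := by
  refine ⟨contDiff_const.add (contDiff_const.mul contDiff_id), ?_⟩
  rw [iteratedDeriv_const_add (by omega), iteratedDeriv_const_mul_field, iteratedDeriv_fun_id_zero,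
    if_neg (by omega), mul_zero]

lemma logExpDiv_mul (hr : 1 ≤ r) (c : ℝ) :
    HasIteratedDerivZero r (fun z => logExpDiv (c * z)) (c ^ r * ((bernoulli' r : ℝ) / r)) :=
  ⟨contDiff_logExpDiv.comp (contDiff_const.mul contDiff_id), by
    rw [iteratedDeriv_comp_const_mul contDiff_logExpDiv]
    simp only [mul_zero, iteratedDeriv_logExpDiv_zero hr]⟩

end HasIteratedDerivZero

/-- Mathlib's logarithm is `log |x|`, so that no care with signs is needed here. -/
lemma log_one_sub_exp_pow {z : ℝ} (hz : z ≠ 0) {j : ℕ} (hj : j ≠ 0) :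
    Real.log (1 - Real.exp z ^ j) = Real.log j + Real.log z + logExpDiv (j * z) := by
  have hj' : (j : ℝ) ≠ 0 := Nat.cast_ne_zero.2 hj
  have : 1 - Real.exp z ^ j = -(j * z * expDiv (j * z)) := by
    rw [mul_expDiv, Real.exp_nat_mul]
    ring
  rw [this, Real.log_neg_eq_log, Real.log_mul (mul_ne_zero hj' hz) (expDiv_pos _).ne',
    Real.log_mul hj' hz, logExpDiv]

lemma log_exp_pow_sub {z : ℝ} (hz : z ≠ 0) {a b : ℕ} (hab : b < a) :
    Real.log (Real.exp z ^ b - Real.exp z ^ a)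
      = Real.log ((a - b : ℕ) : ℝ) + b * z + Real.log z + logExpDiv (((a : ℝ) - b) * z) := by
  have hq : Real.exp z ≠ 1 := fun h => hz (Real.exp_eq_one_iff z |>.1 h)
  have : Real.exp z ^ b - Real.exp z ^ a = Real.exp z ^ b * (1 - Real.exp z ^ (a - b)) := by
    rw [mul_sub, ← pow_add, Nat.add_sub_cancel' hab.le, mul_one]
  rw [this, Real.log_mul (pow_pos (Real.exp_pos z) b).ne'
      (one_sub_pow_ne_zero (Real.exp_pos z) hq (by omega)),
    log_one_sub_exp_pow hz (by omega), Real.log_pow, Real.log_exp, Nat.cast_sub hab.le]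
  ring

/-- The regular part of `log |(q; q)_n|` for `q = exp z`. -/
def logPochPart (n : ℕ) (z : ℝ) : ℝ := ∑ j ∈ range n, logExpDiv (((j + 1 : ℕ) : ℝ) * z)

lemma log_qPoch_exp (n : ℕ) :
    ∃ A : ℝ, ∀ z ≠ 0, Real.log (qPoch (Real.exp z) n) = A + n * Real.log z + logPochPart n z := by
  refine ⟨∑ j ∈ range n, Real.log ((j + 1 : ℕ) : ℝ), fun z hz => ?_⟩
  have hq : Real.exp z ≠ 1 := fun h => hz (Real.exp_eq_one_iff z |>.1 h)
  unfold qPoch logPochPart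
  rw [Real.log_prod fun j _ => one_sub_pow_ne_zero (Real.exp_pos z) hq j.succ_ne_zero,
    sum_congr rfl fun j _ => log_one_sub_exp_pow hz j.succ_ne_zero, sum_add_distrib,
    sum_add_distrib, sum_const, card_range, nsmul_eq_mul]

/-- The regular part of the logarithm of the Vandermonde product of the `q ^ l_a`, `q = exp z`. -/
def logVandermondePart {k : ℕ} (l : Fin k → ℕ) (z : ℝ) : ℝ :=
  ∑ a, ∑ b ∈ Ioi a, logExpDiv (((l a : ℝ) - l b) * z)

lemma log_vandermonde_exp {k : ℕ} {l : Fin k → ℕ} (hl : StrictAnti l) :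
    ∃ A B : ℝ, ∀ z ≠ 0,
      Real.log (∏ a, ∏ b ∈ Ioi a, (Real.exp z ^ l b - Real.exp z ^ l a))
        = A + B * z + (∑ a : Fin k, ((Ioi a).card : ℝ)) * Real.log z + logVandermondePart l z := by
  refine ⟨∑ a, ∑ b ∈ Ioi a, Real.log ((l a - l b : ℕ) : ℝ), ∑ a, ∑ b ∈ Ioi a, (l b : ℝ),
    fun z hz => ?_⟩
  have hq : Real.exp z ≠ 1 := fun h => hz (Real.exp_eq_one_iff z |>.1 h)
  have hne : ∀ a : Fin k, ∀ b ∈ Ioi a, Real.exp z ^ l b - Real.exp z ^ l a ≠ 0 := by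
    intro a b hab h
    exact (hl (mem_Ioi.1 hab)).ne (pow_right_injective₀ (Real.exp_pos z) hq (sub_eq_zero.1 h))
  rw [Real.log_prod fun a _ => prod_ne_zero_iff.2 (hne a)]
  have : ∀ a : Fin k, Real.log (∏ b ∈ Ioi a, (Real.exp z ^ l b - Real.exp z ^ l a))
      = ∑ b ∈ Ioi a, Real.log ((l a - l b : ℕ) : ℝ) + (∑ b ∈ Ioi a, (l b : ℝ)) * z
        + ((Ioi a).card : ℝ) * Real.log z + ∑ b ∈ Ioi a, logExpDiv (((l a : ℝ) - l b) * z) := by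
    intro a
    rw [Real.log_prod (hne a), sum_congr rfl fun b hb => log_exp_pow_sub hz (hl (mem_Ioi.1 hb)),
      sum_add_distrib, sum_add_distrib, sum_add_distrib, sum_const, nsmul_eq_mul, sum_mul]
  rw [sum_congr rfl fun a _ => this a, sum_add_distrib, sum_add_distrib, sum_add_distrib, sum_mul,
    sum_mul, logVandermondePart]

namespace YoungDiagram

variable {μ : YoungDiagram}

/-- The logarithm of the generating function of the major index at `exp z`, up to an affine function
of `z`. The powers of `z` cancel because the product formula has as many factors in the numerator
as in the denominator. -/
lemma log_sum_exp_maj {k : ℕ} (hk : μ.rowLen k = 0) :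
    ∃ A B : ℝ, ∀ z ≠ 0,
      (∑ T : StandardTableau μ, Real.exp z ^ T.maj) ≠ 0 ∧
      Real.log (∑ T : StandardTableau μ, Real.exp z ^ T.maj)
        = A + B * z + (logPochPart μ.card z
          + (logVandermondePart (μ.shiftedRow k) z
              - ∑ a, logPochPart (μ.shiftedRow k a) z)
          - (logVandermondePart ((⊥ : YoungDiagram).shiftedRow k) z
              - ∑ a, logPochPart ((⊥ : YoungDiagram).shiftedRow k a) z)) := by
  obtain ⟨A1, B1, h1⟩ := log_vandermonde_exp (μ.shiftedRow_strictAnti k)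
  obtain ⟨A2, B2, h2⟩ := log_vandermonde_exp ((⊥ : YoungDiagram).shiftedRow_strictAnti k)
  choose P hP using log_qPoch_exp
  refine ⟨P μ.card + A1 - A2 - ∑ a, P (μ.shiftedRow k a)
    + ∑ a, P ((⊥ : YoungDiagram).shiftedRow k a), B1 - B2, fun z hz => ?_⟩
  have hq : Real.exp z ≠ 1 := fun h => hz (Real.exp_eq_one_iff z |>.1 h)
  have hq0 := Real.exp_pos z
  have hV : ∀ ν : YoungDiagram,
      (∏ a, ∏ b ∈ Ioi a, (Real.exp z ^ ν.shiftedRow k b - Real.exp z ^ ν.shiftedRow k a)) ≠ 0 := by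
    intro ν
    refine prod_ne_zero_iff.2 fun a _ => prod_ne_zero_iff.2 fun b hab h => ?_
    exact (ν.shiftedRow_strictAnti k (mem_Ioi.1 hab)).ne
      (pow_right_injective₀ hq0 hq (sub_eq_zero.1 h))
  have hQ : ∀ ν : YoungDiagram, (∏ a, qPoch (Real.exp z) (ν.shiftedRow k a)) ≠ 0 := fun ν =>
    prod_ne_zero_iff.2 fun a _ => qPoch_ne_zero hq0 hq _
  have hlogQ : ∀ ν : YoungDiagram, Real.log (∏ a, qPoch (Real.exp z) (ν.shiftedRow k a))
      = ∑ a, P (ν.shiftedRow k a) + (∑ a, (ν.shiftedRow k a : ℝ)) * Real.log z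
        + ∑ a, logPochPart (ν.shiftedRow k a) z := by
    intro ν
    rw [Real.log_prod fun a _ => qPoch_ne_zero hq0 hq _, sum_congr rfl fun a _ => hP _ z hz,
      sum_add_distrib, sum_add_distrib, sum_mul]
  have hmain := sum_pow_maj_mul hq0 hq hk
  have hF : (∑ T : StandardTableau μ, Real.exp z ^ T.maj) ≠ 0 := by
    intro h0
    rw [h0, zero_mul, zero_mul] at hmain
    exact mul_ne_zero (mul_ne_zero (qPoch_ne_zero hq0 hq _) (hV μ)) (hQ ⊥) hmain.symm
  refine ⟨hF, ?_⟩
  have hlog := congrArg Real.log hmain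
  rw [Real.log_mul (mul_ne_zero hF (hV ⊥)) (hQ μ), Real.log_mul hF (hV ⊥),
    Real.log_mul (mul_ne_zero (qPoch_ne_zero hq0 hq _) (hV μ)) (hQ ⊥),
    Real.log_mul (qPoch_ne_zero hq0 hq _) (hV μ), hP _ z hz, h1 z hz, h2 z hz, hlogQ, hlogQ] at hlog
  have hsum : (∑ a, (μ.shiftedRow k a : ℝ))
      = μ.card + ∑ a, ((⊥ : YoungDiagram).shiftedRow k a : ℝ) := by
    have e1 := sum_shiftedRow hk
    have e2 := sum_shiftedRow (rowLen_bot k)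
    rw [show (⊥ : YoungDiagram).card = 0 from card_empty, zero_add] at e2
    rw [← e2] at e1
    exact_mod_cast e1
  rw [hsum] at hlog
  linear_combination hlog

instance (μ : YoungDiagram) : DiscreteMeasurableSpace (StandardTableau μ) := ⟨fun _ => trivial⟩

lemma nonempty_standardTableau (μ : YoungDiagram) {k : ℕ} (hk : μ.rowLen k = 0) :
    Nonempty (StandardTableau μ) := by
  obtain ⟨A, B, h⟩ := log_sum_exp_maj hk
  by_contra he
  rw [not_nonempty_iff] at he
  exact (h 1 one_ne_zero).1 (by simp)

lemma mgf_maj (μ : YoungDiagram) (z : ℝ) :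
    mgf (fun T : StandardTableau μ => (T.maj : ℝ)) (StandardTableau.uniformLaw μ) z
      = (Fintype.card (StandardTableau μ) : ℝ)⁻¹
          * ∑ T : StandardTableau μ, Real.exp z ^ T.maj := by
  unfold mgf StandardTableau.uniformLaw uniformOn ProbabilityTheory.cond
  rw [integral_smul_measure, Measure.restrict_univ, integral_count, smul_eq_mul]
  congr 1
  · simp [Measure.count_univ, ENat.card_eq_coe_fintype_card]
  · refine sum_congr rfl fun T _ => ?_
    rw [← Real.exp_nat_mul, mul_comm]

/-- For `l` the shifted row lengths of `μ`, this is minus the sum of the `r`-th powers of the hook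
lengths of `μ`; the value for the empty diagram is always subtracted, so that its vanishing is not
needed. -/
def powerDefect (r : ℕ) {k : ℕ} (l : Fin k → ℕ) : ℝ :=
  ∑ a, ∑ b ∈ Ioi a, ((l a : ℝ) - l b) ^ r - ∑ a, ∑ j ∈ range (l a), ((j + 1 : ℕ) : ℝ) ^ r

/-- The exact formula for the cumulants of the major index. -/
theorem cumulant_maj {r : ℕ} (hr : 2 ≤ r) {k : ℕ} (hk : μ.rowLen k = 0) :
    cumulant r (fun T : StandardTableau μ => (T.maj : ℝ)) (StandardTableau.uniformLaw μ)
      = (bernoulli' r : ℝ) / r * (∑ j ∈ range μ.card, ((j + 1 : ℕ) : ℝ) ^ r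
          + powerDefect r (μ.shiftedRow k)
          - powerDefect r ((⊥ : YoungDiagram).shiftedRow k)) := by
  obtain ⟨A, B, h⟩ := log_sum_exp_maj hk
  have := nonempty_standardTableau μ hk
  have hP : ∀ n : ℕ, HasIteratedDerivZero r (logPochPart n)
      (∑ j ∈ range n, ((j + 1 : ℕ) : ℝ) ^ r * ((bernoulli' r : ℝ) / r)) := fun n =>
    HasIteratedDerivZero.sum fun j _ => HasIteratedDerivZero.logExpDiv_mul (by omega) _
  have hV : ∀ l : Fin k → ℕ, HasIteratedDerivZero r (logVandermondePart l)
      (∑ a, ∑ b ∈ Ioi a, ((l a : ℝ) - l b) ^ r * ((bernoulli' r : ℝ) / r)) := fun l =>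
    HasIteratedDerivZero.sum fun a _ => HasIteratedDerivZero.sum fun b _ =>
      HasIteratedDerivZero.logExpDiv_mul (by omega) _
  have hG := fun l : Fin k → ℕ =>
    (hV l).sub (HasIteratedDerivZero.sum (s := univ) fun a _ => hP (l a))
  have hR := (HasIteratedDerivZero.affine hr
      (Real.log (Fintype.card (StandardTableau μ) : ℝ)⁻¹ + A) B).add
    (((hP μ.card).add (hG (μ.shiftedRow k))).sub (hG ((⊥ : YoungDiagram).shiftedRow k)))
  have hpos : ∀ z, 0 < ∑ T : StandardTableau μ, Real.exp z ^ T.maj := fun z =>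
    sum_pos (fun T _ => pow_pos (Real.exp_pos z) _) univ_nonempty
  have hc : (Fintype.card (StandardTableau μ) : ℝ)⁻¹ ≠ 0 :=
    inv_ne_zero (Nat.cast_ne_zero.2 Fintype.card_ne_zero)
  have hcgf : cgf (fun T : StandardTableau μ => (T.maj : ℝ)) (StandardTableau.uniformLaw μ)
      = fun z => Real.log (Fintype.card (StandardTableau μ) : ℝ)⁻¹
          + Real.log (∑ T : StandardTableau μ, Real.exp z ^ T.maj) := by
    ext z
    rw [cgf, mgf_maj, Real.log_mul hc (hpos z).ne']
  have hext := Continuous.ext_on (dense_compl_singleton (0 : ℝ))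
    (f := fun z => Real.log (Fintype.card (StandardTableau μ) : ℝ)⁻¹
      + Real.log (∑ T : StandardTableau μ, Real.exp z ^ T.maj))
    (continuous_const.add (Continuous.log
      (continuous_finsetSum _ fun T _ => Real.continuous_exp.pow _) fun z => (hpos z).ne'))
    hR.contDiff.continuous (fun z hz => by simp only [(h z hz).2]; ring)
  unfold cumulant
  rw [hcgf, hext, hR.eq]
  unfold powerDefect
  simp only [← sum_mul]
  ring

end YoungDiagram

/-! ### Frobenius coordinates and the asymptotics of power sums -/

/-- The sum `1 ^ r + 2 ^ r + ⋯ + m ^ r`. -/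
def powerSum (r m : ℕ) : ℝ := ∑ j ∈ range m, ((j + 1 : ℕ) : ℝ) ^ r

namespace YoungDiagram

variable {μ : YoungDiagram}

lemma rowLen_card (μ : YoungDiagram) : μ.rowLen μ.card = 0 := by
  by_contra h
  have h1 : μ.card < μ.colLen 0 :=
    mem_iff_lt_colLen.1 (mem_iff_lt_rowLen.2 (Nat.pos_of_ne_zero h))
  rw [colLen_eq_card] at h1
  exact absurd (card_le_card (filter_subset _ μ.cells)) (not_le.2 h1)

lemma colLen_le_card (μ : YoungDiagram) (j : ℕ) : μ.colLen j ≤ μ.card := by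
  rw [colLen_eq_card]
  exact card_le_card (filter_subset _ μ.cells)

lemma mem_diag_iff {i : ℕ} : (i, i) ∈ μ ↔ i < μ.diagLen := by
  classical
  have hex : ∃ i, (i, i) ∉ μ := by
    refine ⟨μ.card, fun h => ?_⟩
    have := mem_iff_lt_rowLen.1 h
    rw [rowLen_card] at this
    omega
  have hfind : ∀ i, (i, i) ∈ μ ↔ i < Nat.find hex := by
    intro i
    refine ⟨fun h => ?_, fun h => not_not.1 (Nat.find_min hex h)⟩
    by_contra hle
    exact Nat.find_spec hex (μ.up_left_mem (not_lt.1 hle) (not_lt.1 hle) h)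
  have hcard : μ.diagLen = Nat.find hex := by
    unfold diagLen
    rw [← card_range (Nat.find hex), eq_comm]
    refine card_nbij (fun i => (i, i)) (fun i hi => ?_) (fun i _ j _ h => congrArg Prod.fst h)
      fun c hc => ?_
    · rw [mem_coe, mem_filter, mem_cells, hfind]
      exact ⟨mem_range.1 hi, rfl⟩
    · obtain ⟨a, b⟩ := c
      rw [mem_coe, mem_filter, mem_cells] at hc
      obtain ⟨hc, rfl : a = b⟩ := hc
      exact ⟨a, mem_coe.2 (mem_range.2 ((hfind a).1 hc)), rfl⟩
  rw [hfind, hcard]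

lemma lt_rowLen_of_lt_diagLen {i : ℕ} (h : i < μ.diagLen) : i < μ.rowLen i :=
  mem_iff_lt_rowLen.1 (mem_diag_iff.2 h)

lemma lt_colLen_of_lt_diagLen {i : ℕ} (h : i < μ.diagLen) : i < μ.colLen i :=
  mem_iff_lt_colLen.1 (mem_diag_iff.2 h)

lemma diagLen_le_card (μ : YoungDiagram) : μ.diagLen ≤ μ.card := by
  by_contra h
  have := lt_rowLen_of_lt_diagLen (not_le.1 h)
  rw [rowLen_card] at this
  omega

/-- In the Maya diagram of `μ`, shifted by `n = |μ|`, the particles coming from the rows below the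
diagonal and the holes coming from the columns through the diagonal together fill `{0, …, n - 1}`. -/
lemma sum_particles_add_sum_holes (μ : YoungDiagram) (f : ℕ → ℝ) :
    ∑ i ∈ Ico μ.diagLen μ.card, f (μ.rowLen i + (μ.card - 1 - i))
      + ∑ j ∈ range μ.diagLen, f (μ.card + j - μ.colLen j) = ∑ m ∈ range μ.card, f m := by
  classical
  have hdn := μ.diagLen_le_card
  set n := μ.card with hn
  set d := μ.diagLen with hd
  have hrow : ∀ i, d ≤ i → μ.rowLen i ≤ i := by
    intro i hi
    have : ¬ i < μ.diagLen := not_lt.2 hi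
    rw [← mem_diag_iff, mem_iff_lt_rowLen] at this
    omega
  have hcol : ∀ j < d, j < μ.colLen j ∧ μ.colLen j ≤ n := fun j hj =>
    ⟨lt_colLen_of_lt_diagLen hj, μ.colLen_le_card j⟩
  have hinj1 : Set.InjOn (fun i => μ.rowLen i + (n - 1 - i)) (Ico d n : Finset ℕ) := by
    intro i hi j hj h
    rw [mem_coe, mem_Ico] at hi hj
    simp only at h
    rcases lt_trichotomy i j with hij | hij | hij
    · have := μ.rowLen_anti i j hij.le
      omega
    · exact hij
    · have := μ.rowLen_anti j i hij.le
      omega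
  have hinj2 : Set.InjOn (fun j => n + j - μ.colLen j) (range d : Finset ℕ) := by
    intro i hi j hj h
    rw [mem_coe, mem_range] at hi hj
    simp only at h
    have h1 := hcol i hi
    have h2 := hcol j hj
    rcases lt_trichotomy i j with hij | hij | hij
    · have := μ.colLen_anti i j hij.le
      omega
    · exact hij
    · have := μ.colLen_anti j i hij.le
      omega
  have hdisj : Disjoint ((Ico d n).image fun i => μ.rowLen i + (n - 1 - i))
      ((range d).image fun j => n + j - μ.colLen j) := by
    rw [disjoint_left]
    intro m h1 h2
    obtain ⟨i, hi, rfl⟩ := mem_image.1 h1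
    obtain ⟨j, hj, h⟩ := mem_image.1 h2
    rw [mem_Ico] at hi
    have h3 := hcol j (mem_range.1 hj)
    -- The equation is `μ.rowLen i + μ.colLen j = i + j + 1`; the left side is at least `i + j + 2`
    -- if `(i, j)` is a cell of `μ`, and at most `i + j` otherwise.
    by_cases hm : (i, j) ∈ μ
    · have e1 := mem_iff_lt_rowLen.1 hm
      have e2 := mem_iff_lt_colLen.1 hm
      omega
    · have e1 : ¬ j < μ.rowLen i := fun h => hm (mem_iff_lt_rowLen.2 h)
      have e2 : ¬ i < μ.colLen j := fun h => hm (mem_iff_lt_colLen.2 h)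
      omega
  have hunion : (Ico d n).image (fun i => μ.rowLen i + (n - 1 - i))
      ∪ (range d).image (fun j => n + j - μ.colLen j) = range n := by
    refine eq_of_subset_of_card_le (union_subset ?_ ?_) ?_
    · intro m hm
      obtain ⟨i, hi, rfl⟩ := mem_image.1 hm
      rw [mem_Ico] at hi
      have := hrow i hi.1
      rw [mem_range]
      omega
    · intro m hm
      obtain ⟨j, hj, rfl⟩ := mem_image.1 hm
      have := hcol j (mem_range.1 hj)
      rw [mem_range]
      omega
    · rw [card_union_of_disjoint hdisj, card_image_of_injOn hinj1, card_image_of_injOn hinj2,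
        Nat.card_Ico, card_range, card_range]
      omega
  rw [← hunion, sum_union hdisj, sum_image hinj1, sum_image hinj2]

lemma sum_shiftedRow_bot (n : ℕ) (f : ℕ → ℝ) :
    ∑ a, f ((⊥ : YoungDiagram).shiftedRow n a) = ∑ m ∈ range n, f m := by
  unfold shiftedRow
  simp only [rowLen_bot, zero_add]
  rw [Fin.sum_univ_eq_sum_range (fun a => f (n - 1 - a))]
  exact Finset.sum_range_reflect f n

/-- The signed measure of `μ` relative to the empty diagram is carried by the Frobenius
coordinates. -/
lemma sum_shiftedRow_sub (μ : YoungDiagram) (f : ℕ → ℝ) :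
    ∑ a, f (μ.shiftedRow μ.card a) - ∑ a, f ((⊥ : YoungDiagram).shiftedRow μ.card a)
      = ∑ i ∈ range μ.diagLen,
          (f (μ.card + (μ.rowLen i - i - 1)) - f (μ.card - (μ.colLen i - i))) := by
  have hdn := μ.diagLen_le_card
  rw [sum_shiftedRow_bot, ← sum_particles_add_sum_holes, sum_sub_distrib]
  unfold shiftedRow
  rw [Fin.sum_univ_eq_sum_range (fun a => f (μ.rowLen a + (μ.card - 1 - a))),
    ← sum_range_add_sum_Ico _ hdn]
  have h1 : ∑ i ∈ range μ.diagLen, f (μ.rowLen i + (μ.card - 1 - i))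
      = ∑ i ∈ range μ.diagLen, f (μ.card + (μ.rowLen i - i - 1)) := by
    refine sum_congr rfl fun i hi => ?_
    have := lt_rowLen_of_lt_diagLen (mem_range.1 hi)
    have := mem_range.1 hi
    congr 1
    omega
  have h2 : ∑ i ∈ range μ.diagLen, f (μ.card + i - μ.colLen i)
      = ∑ i ∈ range μ.diagLen, f (μ.card - (μ.colLen i - i)) := by
    refine sum_congr rfl fun i hi => ?_
    have := lt_colLen_of_lt_diagLen (mem_range.1 hi)
    congr 1
    omega
  rw [h1, h2]
  ring

lemma frobeniusA_eq {i : ℕ} (h : i < μ.diagLen) :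
    μ.frobeniusA i = ((μ.rowLen i - i - 1 : ℕ) : ℝ) + 1 / 2 := by
  have := lt_rowLen_of_lt_diagLen h
  unfold frobeniusA
  rw [Nat.sub_sub, Nat.cast_sub (by omega)]
  push_cast
  ring

lemma frobeniusB_eq {i : ℕ} (h : i < μ.diagLen) :
    μ.frobeniusB i = ((μ.colLen i - i - 1 : ℕ) : ℝ) + 1 / 2 := by
  have := lt_colLen_of_lt_diagLen h
  unfold frobeniusB
  rw [Nat.sub_sub, Nat.cast_sub (by omega)]
  push_cast
  ring

/-- The half-integer position of a particle, relative to the shift by `n`. -/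
def position (n l : ℕ) : ℝ := (l : ℝ) - n + 1 / 2

lemma frobeniusMoment_eq {s : ℕ} (hs : 1 ≤ s) :
    μ.frobeniusMoment s = ∑ a, position μ.card (μ.shiftedRow μ.card a) ^ s
      - ∑ a, position μ.card ((⊥ : YoungDiagram).shiftedRow μ.card a) ^ s := by
  rw [sum_shiftedRow_sub μ (fun l => position μ.card l ^ s), sum_sub_distrib, frobeniusMoment,
    mul_sum, sub_eq_add_neg, ← sum_neg_distrib]
  congr 1 <;> refine sum_congr rfl fun i hi => ?_
  · rw [frobeniusA_eq (mem_range.1 hi), position]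
    congr 1
    push_cast
    ring
  · have h1 := lt_colLen_of_lt_diagLen (mem_range.1 hi)
    have h2 := μ.colLen_le_card i
    obtain ⟨m, rfl⟩ : ∃ m, s = m + 1 := ⟨s - 1, by omega⟩
    have : position μ.card (μ.card - (μ.colLen i - i)) = -μ.frobeniusB i := by
      unfold position frobeniusB
      rw [Nat.cast_sub (by omega), Nat.cast_sub h1.le]
      ring
    rw [this, neg_pow, Nat.add_sub_cancel]
    ring

lemma frobeniusMoment_one (μ : YoungDiagram) : μ.frobeniusMoment 1 = μ.card := by
  rw [frobeniusMoment_eq le_rfl]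
  have e1 := sum_shiftedRow μ.rowLen_card
  have e2 := sum_shiftedRow (rowLen_bot μ.card)
  rw [show (⊥ : YoungDiagram).card = 0 from card_empty, zero_add] at e2
  rw [← e2] at e1
  have e3 : (∑ a, (μ.shiftedRow μ.card a : ℝ))
      = μ.card + ∑ a, ((⊥ : YoungDiagram).shiftedRow μ.card a : ℝ) := by exact_mod_cast e1
  simp only [pow_one, position, sum_add_distrib, sum_sub_distrib]
  linarith

end YoungDiagram

lemma Even.pow_sub_comm {r : ℕ} (hr : Even r) (a b : ℝ) : (a - b) ^ r = (b - a) ^ r := by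
  rw [← neg_sub, hr.neg_pow]

lemma sum_Ioi_even_pow {k : ℕ} {r : ℕ} (hr : Even r) (hr0 : r ≠ 0) (x : Fin k → ℝ) :
    ∑ a, ∑ b ∈ Ioi a, (x a - x b) ^ r = 1 / 2 * ∑ a, ∑ b, (x a - x b) ^ r := by
  have h := Finset.sum_sum_Ioi_add_eq_sum_sum_off_diag fun a b => (x a - x b) ^ r
  have h1 : ∀ i : Fin k, ∑ j ∈ {i}ᶜ, (x j - x i) ^ r = ∑ j, (x i - x j) ^ r := by
    intro i
    rw [← Finset.sum_compl_add_sum {i}]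
    rw [sum_singleton, sub_self, zero_pow hr0, add_zero]
    exact sum_congr rfl fun j _ => hr.pow_sub_comm _ _
  rw [sum_congr rfl fun i _ => h1 i] at h
  rw [← h, mul_sum]
  refine sum_congr rfl fun i _ => ?_
  rw [mul_sum]
  refine sum_congr rfl fun j _ => ?_
  rw [hr.pow_sub_comm (x j)]
  ring

lemma sum_sum_sub_pow {k : ℕ} (r : ℕ) (x y : Fin k → ℝ) :
    ∑ a, ∑ b, (x a - y b) ^ r
      = ∑ s ∈ range (r + 1), (r.choose s : ℝ) * (-1) ^ s * (∑ b, y b ^ s) * ∑ a, x a ^ (r - s) := by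
  have : ∀ a b, (x a - y b) ^ r
      = ∑ s ∈ range (r + 1), (r.choose s : ℝ) * (-1) ^ s * (y b ^ s * x a ^ (r - s)) := by
    intro a b
    rw [sub_eq_neg_add, add_pow]
    refine sum_congr rfl fun s _ => ?_
    rw [neg_pow]
    ring
  simp only [this]
  rw [sum_congr rfl fun a _ => sum_comm, sum_comm]
  refine sum_congr rfl fun s _ => ?_
  rw [mul_assoc, Finset.sum_mul_sum, sum_comm, mul_sum]
  exact sum_congr rfl fun b _ => by rw [mul_sum]

lemma powerSum_eq_sum_sub_pow (r l : ℕ) :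
    powerSum r l = ∑ m ∈ range l, ((l : ℝ) - m) ^ r := by
  unfold powerSum
  rw [← Finset.sum_range_reflect]
  refine sum_congr rfl fun j hj => ?_
  have := mem_range.1 hj
  congr 1
  rw [show l - 1 - j + 1 = l - j by omega, Nat.cast_sub this.le]

/-- The interaction of a particle at `l` with the filled positions below `n`, compared with
its interaction with all positions below `l`: case of a particle above `n`. -/
lemma sum_sub_pow_add (r n t : ℕ) :
    ∑ m ∈ range n, (((n + t : ℕ) : ℝ) - m) ^ r - powerSum r (n + t) = -powerSum r t := by
  rw [powerSum_eq_sum_sub_pow, sum_range_add, powerSum_eq_sum_sub_pow]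
  have : ∀ m ∈ range t, (((n + t : ℕ) : ℝ) - ((n + m : ℕ) : ℝ)) ^ r = ((t : ℝ) - m) ^ r :=
    fun m _ => by push_cast; congr 1; ring
  rw [sum_congr rfl this]
  ring

/-- The counterpart of `sum_sub_pow_add` for a position below `n`; evenness of the exponent makes
the differences of either sign contribute alike. -/
lemma sum_sub_pow_sub {r : ℕ} (hr : Even r) (hr0 : r ≠ 0) {n t : ℕ} (ht : t + 1 ≤ n) :
    ∑ m ∈ range n, (((n - (t + 1) : ℕ) : ℝ) - m) ^ r - powerSum r (n - (t + 1))
      = powerSum r t := by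
  obtain ⟨l, rfl⟩ := Nat.exists_eq_add_of_le' ht
  rw [Nat.add_sub_cancel, sum_range_add, powerSum_eq_sum_sub_pow r l, add_sub_cancel_left,
    sum_range_succ', powerSum]
  have : ∀ m ∈ range t, ((l : ℝ) - ((l + (m + 1) : ℕ) : ℝ)) ^ r = ((m + 1 : ℕ) : ℝ) ^ r :=
    fun m _ => by rw [hr.pow_sub_comm]; push_cast; congr 1; ring
  rw [sum_congr rfl this]
  simp [hr0]

namespace YoungDiagram

/-- For even `r`, minus the sum of the `r`-th powers of the hook lengths in terms of the Frobenius
coordinates. Particles are split as the filled sea of the empty diagram plus the signed measure of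
`μ`; the quadratic term in the latter gives products of Frobenius moments, the mixed term gives
power sums of the Frobenius coordinates. -/
theorem powerDefect_sub {r : ℕ} (hr : Even r) (hr0 : r ≠ 0) (μ : YoungDiagram) :
    powerDefect r (μ.shiftedRow μ.card) - powerDefect r ((⊥ : YoungDiagram).shiftedRow μ.card)
      = 1 / 2 * ∑ s ∈ Icc 1 (r - 1), (r.choose s : ℝ) * (-1) ^ s
            * μ.frobeniusMoment s * μ.frobeniusMoment (r - s)
        - ∑ i ∈ range μ.diagLen,
            (powerSum r (μ.rowLen i - i - 1) + powerSum r (μ.colLen i - i - 1)) := by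
  set n := μ.card with hn
  set x : Fin n → ℝ := fun a => position n (μ.shiftedRow n a) with hx
  set e : Fin n → ℝ := fun a => position n ((⊥ : YoungDiagram).shiftedRow n a) with he
  have hpd : ∀ ν : YoungDiagram, powerDefect r (ν.shiftedRow n)
      = 1 / 2 * (∑ a, ∑ b, (position n (ν.shiftedRow n a) - position n (ν.shiftedRow n b)) ^ r)
        - ∑ a, powerSum r (ν.shiftedRow n a) := by
    intro ν
    rw [← sum_Ioi_even_pow hr hr0]
    unfold powerDefect powerSum position
    congr 1
    refine sum_congr rfl fun a _ => sum_congr rfl fun b _ => ?_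
    congr 1
    ring
  have hsym : ∑ a, ∑ b, (e a - x b) ^ r = ∑ a, ∑ b, (x a - e b) ^ r := by
    rw [sum_comm]
    exact sum_congr rfl fun a _ => sum_congr rfl fun b _ => hr.pow_sub_comm _ _
  have hquad : ∑ a, ∑ b, (x a - x b) ^ r - ∑ a, ∑ b, (x a - e b) ^ r
        - ∑ a, ∑ b, (e a - x b) ^ r + ∑ a, ∑ b, (e a - e b) ^ r
      = ∑ s ∈ Icc 1 (r - 1), (r.choose s : ℝ) * (-1) ^ s
            * μ.frobeniusMoment s * μ.frobeniusMoment (r - s) := by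
    simp only [sum_sum_sub_pow]
    rw [← sum_sub_distrib, ← sum_sub_distrib, ← sum_add_distrib]
    have hterm : ∀ s ∈ range (r + 1),
        (r.choose s : ℝ) * (-1) ^ s * (∑ b, x b ^ s) * ∑ a, x a ^ (r - s)
          - (r.choose s : ℝ) * (-1) ^ s * (∑ b, e b ^ s) * ∑ a, x a ^ (r - s)
          - (r.choose s : ℝ) * (-1) ^ s * (∑ b, x b ^ s) * ∑ a, e a ^ (r - s)
          + (r.choose s : ℝ) * (-1) ^ s * (∑ b, e b ^ s) * ∑ a, e a ^ (r - s)
        = (r.choose s : ℝ) * (-1) ^ s * (∑ b, x b ^ s - ∑ b, e b ^ s)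
          * (∑ a, x a ^ (r - s) - ∑ a, e a ^ (r - s)) := fun s _ => by ring
    rw [sum_congr rfl hterm]
    -- The extreme terms vanish because the signed measure has total mass `0`.
    symm
    refine sum_subset_zero_on_sdiff (fun s hs => ?_) (fun s hs => ?_) fun s hs => ?_
    · rw [mem_Icc] at hs
      rw [mem_range]
      omega
    · rw [mem_sdiff, mem_range, mem_Icc] at hs
      rcases Nat.eq_zero_or_pos s with rfl | hs0
      · simp
      · obtain rfl : s = r := by omega
        simp
    · rw [mem_Icc] at hs
      rw [frobeniusMoment_eq hs.1, frobeniusMoment_eq (show 1 ≤ r - s by omega)]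
  have hmixed : ∀ ν : YoungDiagram, ∑ a, ∑ b, (position n (ν.shiftedRow n a) - e b) ^ r
      = ∑ a, ∑ m ∈ range n, ((ν.shiftedRow n a : ℝ) - m) ^ r := by
    intro ν
    refine sum_congr rfl fun a _ => ?_
    rw [← sum_shiftedRow_bot n (fun m => ((ν.shiftedRow n a : ℝ) - m) ^ r)]
    refine sum_congr rfl fun b _ => ?_
    rw [he]
    unfold position
    congr 1
    ring
  have hlin := sum_shiftedRow_sub μ (fun l => ∑ m ∈ range n, ((l : ℝ) - m) ^ r - powerSum r l)
  have hrhs : ∑ i ∈ range μ.diagLen,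
      ((∑ m ∈ range n, (((n + (μ.rowLen i - i - 1) : ℕ) : ℝ) - m) ^ r
          - powerSum r (n + (μ.rowLen i - i - 1)))
        - (∑ m ∈ range n, (((n - (μ.colLen i - i) : ℕ) : ℝ) - m) ^ r
          - powerSum r (n - (μ.colLen i - i))))
      = - ∑ i ∈ range μ.diagLen,
            (powerSum r (μ.rowLen i - i - 1) + powerSum r (μ.colLen i - i - 1)) := by
    rw [← sum_neg_distrib]
    refine sum_congr rfl fun i hi => ?_
    have h1 := lt_colLen_of_lt_diagLen (mem_range.1 hi)
    have h2 := μ.colLen_le_card i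
    obtain ⟨t, ht⟩ : ∃ t, μ.colLen i - i = t + 1 := ⟨μ.colLen i - i - 1, by omega⟩
    rw [ht, sum_sub_pow_add, sum_sub_pow_sub hr hr0 (by omega), Nat.add_sub_cancel]
    ring
  rw [hrhs] at hlin
  simp only [sum_sub_distrib] at hlin
  rw [← hmixed, ← hmixed] at hlin
  rw [hpd, hpd, ← hquad, hsym]
  linear_combination hlin

end YoungDiagram

/-- A polynomial of degree at most `p` is `O((m + 1/2) ^ p)` on the natural numbers. -/
lemma exists_bound_sum_mul_pow {p N : ℕ} (hN : N ≤ p + 1) (c : ℕ → ℝ) :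
    ∃ C : ℝ, 0 ≤ C ∧ ∀ m : ℕ, |∑ i ∈ range N, c i * (m : ℝ) ^ (p - i)|
      ≤ C * ((m : ℝ) + 1 / 2) ^ p := by
  refine ⟨∑ i ∈ range N, |c i| * 2 ^ i, sum_nonneg fun i _ => by positivity, fun m => ?_⟩
  rw [sum_mul]
  refine (abs_sum_le_sum_abs _ _).trans (sum_le_sum fun i hi => ?_)
  have hm : (0 : ℝ) ≤ m := Nat.cast_nonneg m
  rw [abs_mul, abs_of_nonneg (pow_nonneg hm _), mul_assoc]
  refine mul_le_mul_of_nonneg_left ?_ (abs_nonneg _)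
  have hi' : i ≤ p := by have := mem_range.1 hi; omega
  calc (m : ℝ) ^ (p - i) ≤ ((m : ℝ) + 1 / 2) ^ (p - i) := by gcongr; linarith
    _ ≤ ((m : ℝ) + 1 / 2) ^ (p - i) * (2 * ((m : ℝ) + 1 / 2)) ^ i :=
        le_mul_of_one_le_right (by positivity) (one_le_pow₀ (by linarith))
    _ = 2 ^ i * (((m : ℝ) + 1 / 2) ^ (p - i) * ((m : ℝ) + 1 / 2) ^ i) := by
        rw [mul_pow]
        ring
    _ = 2 ^ i * ((m : ℝ) + 1 / 2) ^ p := by rw [← pow_add, Nat.sub_add_cancel hi']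

/-- The two leading terms of Faulhaber's formula. -/
lemma exists_bound_powerSum {r : ℕ} (hr : 2 ≤ r) :
    ∃ C : ℝ, 0 ≤ C ∧ ∀ m : ℕ,
      |powerSum r m - ((m : ℝ) ^ (r + 1) / (r + 1) + (m : ℝ) ^ r / 2)|
        ≤ C * ((m : ℝ) + 1 / 2) ^ (r - 1) := by
  obtain ⟨p, rfl⟩ : ∃ p, r = p + 2 := ⟨r - 2, by omega⟩
  obtain ⟨C, hC0, hC⟩ := exists_bound_sum_mul_pow (p := p + 1) (N := p + 1) (by omega) fun i =>
    (bernoulli' (i + 1 + 1) : ℝ) * ((p + 2 + 1).choose (i + 1 + 1) : ℝ) / ((p : ℝ) + 2 + 1)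
  refine ⟨C, hC0, fun m => ?_⟩
  have h : powerSum (p + 2) m = ∑ i ∈ range (p + 2 + 1), (bernoulli' i : ℝ)
      * ((p + 2 + 1).choose i : ℝ) * (m : ℝ) ^ (p + 2 + 1 - i) / ((p : ℝ) + 2 + 1) := by
    have h1 := congrArg (fun x : ℚ => (x : ℝ)) (sum_Ico_pow m (p + 2))
    push_cast at h1
    rw [← h1, powerSum, sum_Ico_eq_sum_range, Nat.add_sub_cancel]
    exact sum_congr rfl fun j _ => by push_cast; rw [add_comm]
  rw [sum_range_succ', sum_range_succ'] at h
  have hp : (p : ℝ) + 2 + 1 ≠ 0 := by positivity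
  have h2 : powerSum (p + 2) m
      - ((m : ℝ) ^ (p + 2 + 1) / ((p + 2 : ℕ) + 1) + (m : ℝ) ^ (p + 2) / 2)
      = ∑ i ∈ range (p + 1), (bernoulli' (i + 1 + 1) : ℝ) * ((p + 2 + 1).choose (i + 1 + 1) : ℝ)
          / ((p : ℝ) + 2 + 1) * (m : ℝ) ^ (p + 1 - i) := by
    rw [h, zero_add, bernoulli'_one, bernoulli'_zero, Nat.choose_one_right, Nat.choose_zero_right,
      Nat.add_sub_cancel, Nat.sub_zero]
    have : ∀ i ∈ range (p + 1), (bernoulli' (i + 1 + 1) : ℝ)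
        * ((p + 2 + 1).choose (i + 1 + 1) : ℝ) * (m : ℝ) ^ (p + 2 + 1 - (i + 1 + 1))
          / ((p : ℝ) + 2 + 1)
        = (bernoulli' (i + 1 + 1) : ℝ) * ((p + 2 + 1).choose (i + 1 + 1) : ℝ)
          / ((p : ℝ) + 2 + 1) * (m : ℝ) ^ (p + 1 - i) := fun i _ => by
      rw [show p + 2 + 1 - (i + 1 + 1) = p + 1 - i by omega]
      ring
    rw [sum_congr rfl this]
    push_cast
    field_simp
    ring
  rw [h2]
  exact hC m

/-- In the variable `m + 1/2` the second leading term of Faulhaber's formula disappears. -/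
lemma exists_bound_powerSum_half {r : ℕ} (hr : 2 ≤ r) :
    ∃ C : ℝ, 0 ≤ C ∧ ∀ m : ℕ,
      |powerSum r m - ((m : ℝ) + 1 / 2) ^ (r + 1) / (r + 1)|
        ≤ C * ((m : ℝ) + 1 / 2) ^ (r - 1) := by
  obtain ⟨C1, hC10, hC1⟩ := exists_bound_powerSum hr
  obtain ⟨p, rfl⟩ : ∃ p, r = p + 2 := ⟨r - 2, by omega⟩
  obtain ⟨C2, hC20, hC2⟩ := exists_bound_sum_mul_pow (p := p + 1) (N := p + 2) (by omega) fun i =>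
    (1 / 2 : ℝ) ^ (i + 1 + 1) * ((p + 2 + 1).choose (i + 1 + 1) : ℝ) / ((p : ℝ) + 2 + 1)
  refine ⟨C1 + C2, add_nonneg hC10 hC20, fun m => ?_⟩
  have hp : (p : ℝ) + 2 + 1 ≠ 0 := by positivity
  have h : ((m : ℝ) + 1 / 2) ^ (p + 2 + 1) / ((p + 2 : ℕ) + 1)
      - ((m : ℝ) ^ (p + 2 + 1) / ((p + 2 : ℕ) + 1) + (m : ℝ) ^ (p + 2) / 2)
      = ∑ i ∈ range (p + 2), (1 / 2 : ℝ) ^ (i + 1 + 1) * ((p + 2 + 1).choose (i + 1 + 1) : ℝ)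
          / ((p : ℝ) + 2 + 1) * (m : ℝ) ^ (p + 1 - i) := by
    rw [add_comm, add_pow, sum_range_succ', sum_range_succ']
    have : ∀ i ∈ range (p + 2), (1 / 2 : ℝ) ^ (i + 1 + 1)
        * (m : ℝ) ^ (p + 2 + 1 - (i + 1 + 1)) * ((p + 2 + 1).choose (i + 1 + 1) : ℝ)
        = ((1 / 2 : ℝ) ^ (i + 1 + 1) * ((p + 2 + 1).choose (i + 1 + 1) : ℝ)
          / ((p : ℝ) + 2 + 1) * (m : ℝ) ^ (p + 1 - i)) * ((p : ℝ) + 2 + 1) := fun i _ => by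
      rw [show p + 2 + 1 - (i + 1 + 1) = p + 1 - i by omega]
      field_simp
    rw [sum_congr rfl this, ← sum_mul, zero_add, Nat.choose_one_right, Nat.choose_zero_right,
      Nat.add_sub_cancel, Nat.sub_zero]
    push_cast
    field_simp
    ring
  have h1 := hC1 m
  have h2 := hC2 m
  rw [← h, abs_sub_comm] at h2
  rw [add_mul]
  refine (abs_sub_le _ _ _).trans (add_le_add h1 h2)

namespace YoungDiagram

lemma sum_frobeniusA_add_sum_frobeniusB (μ : YoungDiagram) :
    ∑ i ∈ range μ.diagLen, μ.frobeniusA i + ∑ i ∈ range μ.diagLen, μ.frobeniusB i = μ.card := by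
  rw [← frobeniusMoment_one]
  simp [frobeniusMoment]

end YoungDiagram

lemma sum_pow_le_pow {ι : Type*} {s : Finset ι} {f : ι → ℝ} {N : ℝ} (hf : ∀ i ∈ s, 0 ≤ f i)
    (hN : ∑ i ∈ s, f i ≤ N) {p : ℕ} (hp : 1 ≤ p) : ∑ i ∈ s, f i ^ p ≤ N ^ p := by
  obtain ⟨m, rfl⟩ : ∃ m, p = m + 1 := ⟨p - 1, by omega⟩
  have hN0 : 0 ≤ N := (sum_nonneg hf).trans hN
  calc ∑ i ∈ s, f i ^ (m + 1) ≤ ∑ i ∈ s, N ^ m * f i := sum_le_sum fun i hi => by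
        rw [pow_succ]
        exact mul_le_mul_of_nonneg_right
          (pow_le_pow_left₀ (hf i hi) ((single_le_sum hf hi).trans hN) m) (hf i hi)
    _ ≤ N ^ (m + 1) := by
        rw [← mul_sum, pow_succ]
        exact mul_le_mul_of_nonneg_left hN (pow_nonneg hN0 m)

open YoungDiagram in
/-- The estimate for even `r` and a single diagram. -/
lemma exists_bound_cumulant_of_even {r : ℕ} (hr : 2 ≤ r) (he : Even r) :
    ∃ C : ℝ, ∀ μ : YoungDiagram, 1 ≤ μ.card →
      |cumulant r (fun T : StandardTableau μ => (T.maj : ℝ)) (StandardTableau.uniformLaw μ)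
          - ((bernoulli' r : ℝ) / ((r : ℝ) * ((r : ℝ) + 1))
                * (μ.frobeniusMoment 1 ^ (r + 1) - μ.frobeniusMoment (r + 1))
              + (bernoulli' r : ℝ) / (2 * (r : ℝ))
                * (μ.frobeniusMoment 1 ^ r
                  + ∑ s ∈ Finset.Icc 1 (r - 1), (r.choose s : ℝ) * (-1) ^ s
                      * μ.frobeniusMoment s * μ.frobeniusMoment (r - s)))|
        ≤ C * (μ.card : ℝ) ^ (r - 1) := by
  obtain ⟨C1, hC10, hC1⟩ := exists_bound_powerSum hr
  obtain ⟨C2, hC20, hC2⟩ := exists_bound_powerSum_half hr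
  refine ⟨|(bernoulli' r : ℝ) / r| * (C1 * 2 ^ (r - 1) + (C2 + C2)), fun μ hμ => ?_⟩
  have hr0 : (r : ℝ) ≠ 0 := by positivity
  have hr1 : (r : ℝ) + 1 ≠ 0 := by positivity
  have hn : (1 : ℝ) ≤ μ.card := by exact_mod_cast hμ
  set EA : ℝ := ∑ i ∈ range μ.diagLen,
    (powerSum r (μ.rowLen i - i - 1) - μ.frobeniusA i ^ (r + 1) / (r + 1)) with hEA
  set EB : ℝ := ∑ i ∈ range μ.diagLen,
    (powerSum r (μ.colLen i - i - 1) - μ.frobeniusB i ^ (r + 1) / (r + 1)) with hEB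
  set E0 : ℝ := powerSum r μ.card
    - ((μ.card : ℝ) ^ (r + 1) / (r + 1) + (μ.card : ℝ) ^ r / 2) with hE0
  have hmoment : μ.frobeniusMoment (r + 1) = ∑ i ∈ range μ.diagLen, μ.frobeniusA i ^ (r + 1)
      + ∑ i ∈ range μ.diagLen, μ.frobeniusB i ^ (r + 1) := by
    rw [frobeniusMoment, Nat.add_sub_cancel, he.neg_one_pow, one_mul]
  have hkey : cumulant r (fun T : StandardTableau μ => (T.maj : ℝ)) (StandardTableau.uniformLaw μ)
          - ((bernoulli' r : ℝ) / ((r : ℝ) * ((r : ℝ) + 1))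
                * (μ.frobeniusMoment 1 ^ (r + 1) - μ.frobeniusMoment (r + 1))
              + (bernoulli' r : ℝ) / (2 * (r : ℝ))
                * (μ.frobeniusMoment 1 ^ r
                  + ∑ s ∈ Finset.Icc 1 (r - 1), (r.choose s : ℝ) * (-1) ^ s
                      * μ.frobeniusMoment s * μ.frobeniusMoment (r - s)))
      = (bernoulli' r : ℝ) / r * (E0 - (EA + EB)) := by
    rw [cumulant_maj hr μ.rowLen_card, add_sub_assoc, powerDefect_sub he (by omega),
      frobeniusMoment_one, hmoment, hE0, hEA, hEB, sum_sub_distrib, sum_sub_distrib,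
      ← sum_div, ← sum_div, sum_add_distrib]
    change _ / _ * (powerSum r μ.card + _) - _ = _
    field_simp
    ring
  have hA0 : ∀ i ∈ range μ.diagLen, 0 ≤ μ.frobeniusA i := fun i hi => by
    rw [frobeniusA_eq (mem_range.1 hi)]
    positivity
  have hB0 : ∀ i ∈ range μ.diagLen, 0 ≤ μ.frobeniusB i := fun i hi => by
    rw [frobeniusB_eq (mem_range.1 hi)]
    positivity
  have hsum := μ.sum_frobeniusA_add_sum_frobeniusB
  have hA := sum_nonneg hA0
  have hB := sum_nonneg hB0
  have bA : |EA| ≤ C2 * (μ.card : ℝ) ^ (r - 1) := by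
    refine (abs_sum_le_sum_abs _ _).trans ((sum_le_sum fun i hi => ?_).trans
      ((mul_sum (range μ.diagLen) (fun i => μ.frobeniusA i ^ (r - 1)) C2).symm.le.trans
        (mul_le_mul_of_nonneg_left (sum_pow_le_pow hA0 (by linarith) (by omega)) hC20)))
    rw [frobeniusA_eq (mem_range.1 hi)]
    exact hC2 _
  have bB : |EB| ≤ C2 * (μ.card : ℝ) ^ (r - 1) := by
    refine (abs_sum_le_sum_abs _ _).trans ((sum_le_sum fun i hi => ?_).trans
      ((mul_sum (range μ.diagLen) (fun i => μ.frobeniusB i ^ (r - 1)) C2).symm.le.trans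
        (mul_le_mul_of_nonneg_left (sum_pow_le_pow hB0 (by linarith) (by omega)) hC20)))
    rw [frobeniusB_eq (mem_range.1 hi)]
    exact hC2 _
  have b0 : |E0| ≤ C1 * 2 ^ (r - 1) * (μ.card : ℝ) ^ (r - 1) := by
    refine (hC1 μ.card).trans ?_
    rw [mul_assoc, ← mul_pow]
    exact mul_le_mul_of_nonneg_left (pow_le_pow_left₀ (by positivity) (by linarith) _) hC10
  rw [hkey, abs_mul, mul_assoc]
  refine mul_le_mul_of_nonneg_left ?_ (abs_nonneg _)
  calc |E0 - (EA + EB)| ≤ |E0| + (|EA| + |EB|) :=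
        (abs_sub _ _).trans (add_le_add_right (abs_add_le _ _) _)
    _ ≤ _ := by rw [add_mul, add_mul]; linarith

end

theorem mainTheorem4 (r : ℕ) (hr : 2 ≤ r) :
    ∃ C : ℝ, ∀ lam : ℕ → YoungDiagram, IsGrowing lam → ∀ n : ℕ, 1 ≤ n →
      |cumulant r (fun T : StandardTableau (lam n) => (T.maj : ℝ))
            (StandardTableau.uniformLaw (lam n))
          - ((bernoulli' r : ℝ) / ((r : ℝ) * ((r : ℝ) + 1))
                * ((lam n).frobeniusMoment 1 ^ (r + 1) - (lam n).frobeniusMoment (r + 1))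
              + (bernoulli' r : ℝ) / (2 * (r : ℝ))
                * ((lam n).frobeniusMoment 1 ^ r
                  + ∑ s ∈ Finset.Icc 1 (r - 1), (r.choose s : ℝ) * (-1) ^ s
                      * (lam n).frobeniusMoment s * (lam n).frobeniusMoment (r - s)))|
        ≤ C * (n : ℝ) ^ (r - 1) := by
  rcases Nat.even_or_odd r with he | ho
  · obtain ⟨C, hC⟩ := exists_bound_cumulant_of_even hr he
    refine ⟨C, fun lam hlam n hn => ?_⟩
    have := hC (lam n) (by rw [hlam n hn]; exact hn)
    rwa [hlam n hn] at this
  · -- The Bernoulli number vanishes, and with it the cumulant and its main term.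
    refine ⟨0, fun lam _ n _ => ?_⟩
    rw [YoungDiagram.cumulant_maj hr (lam n).rowLen_card, bernoulli'_eq_zero_of_odd ho (by omega)]
    simp
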